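/- **Theorem.** There is $k_0$ such that for every integer $k\ge k_0$ and every real $c\ge 0.7\cdot 2^k$ there is $\varepsilon>0$ such that the following holds. Let $(F_n)_{n}$ be independent random CNFs, where, for every $n\ge k$, $F_n$ has $n$ variables and $\lfloor cn\rfloor$ clauses chosen independently and uniformly among the $\binom nk 2^k$ clauses consisting of $k$ literals on $k$ distinct variables. Then, with probability $1$, for all sufficiently large $n$: $F_n$ is unsatisfiable, and there is a non-uniform decision tree reduction of block-depth $2$ from the problem $\mathrm{Refuter}(s(F_n)<(1+\varepsilon)^n)$ to $\mathrm{rwPHP}(\mathrm{PLS})$, i.e. for every length $L$ with $1\le L\le(1+\varepsilon)^n$ there is such a reduction from $\mathrm{Refuter}_L(F_n)$ to $\mathrm{rwPHP}(\mathrm{PLS})$. The notions are as follows (with $[N]=\{0,\dots,N-1\}$). *Refuter.* Let $F$ be a CNF with $n$ variables and axioms $C_{-m},\dots,C_{-1}$. An input of $\mathrm{Refuter}_L(F)$ is a sequence of nodes $C_0,\dots,C_{L-1}$; each node is one block and consists of a set of literals (a clause) and a tag, which is either "resolution" with two indices $j,k'\in\{-m,\dots,L-1\}$ and a variable $x_a$,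 or "weakening" with one index $j\in\{-m,\dots,L-1\}$. Node $i$ is valid if the indices in its tag are less than $i$; and $C_j=x_a\vee D$, $C_{k'}=\bar x_a\vee E$, $C_i=D\vee E$ for some clauses $D,E$ (resolution), respectively $C_i=C_j\vee D$ for some clause $D$ (weakening); and, if $i=L-1$, $C_i$ is the empty clause. A solution is an index $i\in[L]$ of a node that is not valid. *$\mathrm{rwPHP}(\mathrm{PLS})$.* An instance of $\mathrm{Iter}$ is a function $S:[K]\to[K]$ with $K\ge1$; a solution is an $x\in[K]$ with $x=0=S(0)$, or $S(x)<x$, or $S(x)>x$ and $S(S(x))=S(x)$. An instance of $\mathrm{rwPHP}(\mathrm{PLS})$ with parameters $M\ge 1$, $N\ge 2M$, $K\ge1$ consists of a function $f:[M]\to[N]$ and, for every $y\in[N]$, an instance $S_y:[K]\to[K]$ of $\mathrm{Iter}$ and a function $g_y:[K]\to[M]$; each function value is one block. A solution is a pair $(y,ans)\in[N]\times[K]$ such that $ans$ is a solution of $S_y$ and $f(g_y(ans))\ne y$. *Reductions.* A (non-uniform) decision tree reduction of block-depth $d$ from a search problem $P$, at a given input length, to $\mathrm{rwPHP}(\mathrm{PLS})$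 consists of parameters $M,N,K$ as above, a decision tree for every block of the $\mathrm{rwPHP}(\mathrm{PLS})$ instance, computing its content from an input $x$ of $P$, and a decision tree for every possible solution $o$ of that instance, computing from $x$ a candidate solution of $x$. Every tree queries at most $d$ blocks of $x$ on every path. For every $x$ and every solution $o$ of the instance computed from $x$, the answer computed for $o$ is a solution of $x$. Moreover the bit length of the instance is at most $2^{dB}$, where $B$ is the largest number of bits in a block of $P$ (a block with $v$ possible contents having $\lceil\log_2 v\rceil$ bits). -/

import Mathlib

open MeasureTheory ProbabilityTheory Filter

noncomputable section

namespace ResRefuter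

/-! ### Clauses, CNFs and random k-CNFs -/

/-- A literal over the variables `x_v`, `v : Fin n`: the pair `(v, true)` stands for `x_v` and
`(v, false)` for its negation. -/
abbrev Literal (n : ℕ) : Type := Fin n × Bool

/-- A clause is a finite set of literals, read as their disjunction. -/
abbrev Clause (n : ℕ) : Type := Finset (Literal n)

/-- A CNF with `n` variables and `m` clauses, as a list of `m` clauses. -/
abbrev CNF (n m : ℕ) : Type := Fin m → Clause n

/-- `α` satisfies `C`: some literal of `C` is true under `α`. -/
def Clause.Sat {n : ℕ} (C : Clause n) (α : Fin n → Bool) : Prop :=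
  ∃ l ∈ C, α l.1 = l.2

/-- No assignment satisfies all clauses of `F`. -/
def CNF.Unsat {n m : ℕ} (F : CNF n m) : Prop :=
  ¬ ∃ α : Fin n → Bool, ∀ i, Clause.Sat (F i) α

/-- The ordinary clauses of size `k`: `k` literals, no variable occurring with both signs. -/
def ordinaryClauses (k n : ℕ) : Set (Clause n) :=
  {C | C.card = k ∧ ∀ v : Fin n, ¬ ((v, true) ∈ C ∧ (v, false) ∈ C)}

/-- All sets of clauses are measurable (there are finitely many clauses). -/
instance instMeasurableSpaceClause (n : ℕ) : MeasurableSpace (Clause n) := ⊤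

/-- The distribution `𝓕(k, n, m)`: `m` independent clauses, each uniform among the ordinary
clauses of size `k` over `n` variables. It is a probability measure when `k ≤ n`. -/
def randomKCNF (k n m : ℕ) : Measure (CNF n m) :=
  Measure.pi fun _ : Fin m => uniformOn (ordinaryClauses k n)

/-! ### Search problems whose inputs are divided into blocks, and decision trees -/

/-- A search problem at one input length. An input assigns to every block its content; `IsSol x o`
says that `o` is a solution of the input `x`. -/
structure SearchProblem where
  Block : Type
  Val : Block → Type
  Sol : Type
  [fintypeBlock : Fintype Block]
  [finiteVal : ∀ b, Finite (Val b)]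
  [fintypeSol : Fintype Sol]
  IsSol : (∀ b, Val b) → Sol → Prop

attribute [instance] SearchProblem.fintypeBlock SearchProblem.finiteVal SearchProblem.fintypeSol

namespace SearchProblem

/-- The inputs of `P`. -/
abbrev Input (P : SearchProblem) : Type := ∀ b, P.Val b

/-- The number of bits in which the content of the block `b` is written. -/
def bits (P : SearchProblem) (b : P.Block) : ℕ := Nat.clog 2 (Nat.card (P.Val b))

/-- The largest number of bits of a block. -/
def blockBits (P : SearchProblem) : ℕ := Finset.univ.sup P.bits

/-- The number of bits of an input. -/
def bitLength (P : SearchProblem) : ℕ := ∑ b, P.bits b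

end SearchProblem

/-- Decision trees with outputs in `α` that query whole blocks of an input of `P`. -/
inductive BlockTree (P : SearchProblem) (α : Type) : Type
  | leaf (a : α) : BlockTree P α
  | query (b : P.Block) (next : P.Val b → BlockTree P α) : BlockTree P α

namespace BlockTree

/-- The output of the decision tree on the input `x`. -/
def eval {P : SearchProblem} {α : Type} : BlockTree P α → P.Input → α
  | leaf a, _ => a
  | query b next, x => (next (x b)).eval x

/-- The tree queries at most `d` blocks on every path. -/
def DepthLE {P : SearchProblem} {α : Type} : BlockTree P α → ℕ → Prop
  | leaf _, _ => True
  | query _ _, 0 => False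
  | query _ next, d + 1 => ∀ v, (next v).DepthLE d

end BlockTree

/-- A (non-uniform, many-one) decision tree reduction of block-depth `d` from `P` to `Q`.
A tree that queries `d` blocks of `P` queries at most `d * P.blockBits` bits; the last field is the
usual requirement that the input of `Q` be at most exponentially long in this number. -/
structure Reduction (P Q : SearchProblem) (d : ℕ) where
  /-- the tree computing a block of the instance of `Q` -/
  inst : ∀ b : Q.Block, BlockTree P (Q.Val b)
  /-- the tree computing a solution of the input of `P` from a solution of the instance of `Q` -/
  sol : Q.Sol → BlockTree P P.Sol
  inst_depth : ∀ b, (inst b).DepthLE d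
  sol_depth : ∀ o, (sol o).DepthLE d
  correct : ∀ (x : P.Input) (o : Q.Sol),
    Q.IsSol (fun b => (inst b).eval x) o → P.IsSol x ((sol o).eval x)
  size_le : Q.bitLength ≤ 2 ^ (d * P.blockBits)

/-! ### `Iter` and the retraction weak pigeonhole principle over `PLS` -/

/-- The problem `Iter` on functions `S : [L] → [L]`, each value of `S` being a block. -/
def iter (L : ℕ) : SearchProblem where
  Block := Fin L
  Val _ := Fin L
  Sol := Fin L
  IsSol S x :=
    ((x : ℕ) = 0 ∧ S x = x) ∨ S x < x ∨ (x < S x ∧ S (S x) = S x)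

/-- The blocks of an instance of the retraction weak pigeonhole principle over `P`: the values of
the purported surjection `f : [M] → [N]`, the blocks of the instances `I_y` of `P` (`y ∈ [N]`),
and the values of the functions `g_y` from candidate solutions of `I_y` to `[M]`. -/
inductive RwBlock (P : SearchProblem) (M N : ℕ) : Type
  | f (z : Fin M) : RwBlock P M N
  | inst (y : Fin N) (b : P.Block) : RwBlock P M N
  | g (y : Fin N) (ans : P.Sol) : RwBlock P M N

/-- `RwBlock` as a sum type. -/
def RwBlock.equivSum (P : SearchProblem) (M N : ℕ) :
    (Fin M ⊕ (Fin N × P.Block) ⊕ (Fin N × P.Sol)) ≃ RwBlock P M N where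
  toFun
    | .inl z => .f z
    | .inr (.inl p) => .inst p.1 p.2
    | .inr (.inr p) => .g p.1 p.2
  invFun
    | .f z => .inl z
    | .inst y b => .inr (.inl (y, b))
    | .g y ans => .inr (.inr (y, ans))
  left_inv := by rintro (_ | _ | _) <;> rfl
  right_inv := by rintro (_ | _ | _) <;> rfl

instance RwBlock.instFintype (P : SearchProblem) (M N : ℕ) : Fintype (RwBlock P M N) :=
  Fintype.ofEquiv _ (RwBlock.equivSum P M N)

/-- The contents of the blocks. -/
def RwBlock.Val {P : SearchProblem} {M N : ℕ} : RwBlock P M N → Type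
  | .f _ => Fin N
  | .inst _ b => P.Val b
  | .g _ _ => Fin M

instance RwBlock.instFiniteVal {P : SearchProblem} {M N : ℕ} (b : RwBlock P M N) :
    Finite b.Val := by
  cases b
  · exact inferInstanceAs (Finite (Fin N))
  · exact inferInstanceAs (Finite (P.Val _))
  · exact inferInstanceAs (Finite (Fin M))

/-- The problem `rwPHP(P)` with parameters `M` and `N`: find `y ∈ [N]` and a solution `ans` of
`I_y` such that `f (g_y ans) ≠ y`. -/
def rwPHP (P : SearchProblem) (M N : ℕ) : SearchProblem where
  Block := RwBlock P M N
  Val b := b.Val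
  Sol := Fin N × P.Sol
  IsSol x o :=
    P.IsSol (fun b => (x (.inst o.1 b) : P.Val b)) o.2 ∧
      (x (.f (x (.g o.1 o.2) : Fin M)) : Fin N) ≠ o.1

/-- `P` reduces with block-depth `d` to `rwPHP(PLS)`, that is, to the problem `rwPHP(Iter)` with
some admissible parameters. -/
def ReducesToRwPHPPLS (P : SearchProblem) (d : ℕ) : Prop :=
  ∃ M N L : ℕ, 1 ≤ M ∧ 2 * M ≤ N ∧ 1 ≤ L ∧ Nonempty (Reduction P (rwPHP (iter L) M N) d)

/-! ### Purported resolution refutations and the refuter problem -/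

/-- A premise is either an axiom (`.inl`) or a node of the refutation (`.inr`). -/
abbrev Premise (m L : ℕ) : Type := Fin m ⊕ Fin L

/-- The tag of a node: the two premises and the resolved variable, or the premise that is
weakened. -/
abbrev Tag (n m L : ℕ) : Type := (Premise m L × Premise m L × Fin n) ⊕ Premise m L

/-- A node of a purported refutation: a set of literals and a tag. -/
abbrev Node (n m L : ℕ) : Type := Clause n × Tag n m L

/-- The clause written on a premise. -/
def premiseClause {n m L : ℕ} (F : CNF n m) (p : Fin L → Node n m L) : Premise m L → Clause n
  | .inl i => F i
  | .inr j => (p j).1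

/-- The premise is an axiom or a node that precedes node `i`. -/
def Premise.Before {m L : ℕ} (i : Fin L) : Premise m L → Prop
  | .inl _ => True
  | .inr j => j < i

/-- The derivation of node `i` follows its tag: in a resolution step the premises are `x_a ∨ D` and
`¬x_a ∨ E` and the conclusion is `D ∨ E`; in a weakening step the conclusion is `C_j ∨ D`. -/
def ValidStep {n m L : ℕ} (F : CNF n m) (p : Fin L → Node n m L) (i : Fin L) : Prop :=
  match (p i).2 with
  | .inl (j, k, a) =>
      Premise.Before i j ∧ Premise.Before i k ∧
        ∃ D E : Clause n,
          premiseClause F p j = insert (a, true) D ∧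
          premiseClause F p k = insert (a, false) E ∧
          (p i).1 = D ∪ E
  | .inr j =>
      Premise.Before i j ∧ ∃ D : Clause n, (p i).1 = premiseClause F p j ∪ D

/-- Node `i` satisfies the validity conditions; the last node must carry the empty clause. -/
def ValidNode {n m L : ℕ} (F : CNF n m) (p : Fin L → Node n m L) (i : Fin L) : Prop :=
  ValidStep F p i ∧ ((i : ℕ) + 1 = L → (p i).1 = ∅)

/-- The refuter problem for refutations of `F` with `L` nodes: given a purported refutation, each
node being a block, find a node that violates the validity conditions. -/
def refuter {n m : ℕ} (F : CNF n m) (L : ℕ) : SearchProblem where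
  Block := Fin L
  Val _ := Node n m L
  Sol := Fin L
  IsSol p i := ¬ ValidNode F p i

end ResRefuter

end

/-!
A resolution refutation with `L ≤ (1 + ε) ^ n` nodes is refuted by a restriction followed by a
width argument, and the reduction is a constructive reading of that proof.

Call a clause of medium complexity for a restriction `ρ` (`Medium`) if under `ρ` it follows from
`2 * s` axioms but not from `s`. If any set of at most `2 * s` axioms has at least as many unset
boundary variables as members (`BoundaryExpanding`), then the empty clause does not follow from
`2 * s` axioms, and a clause of medium complexity contains more than `s` variables and no literal
made true by `ρ` (`Medium.wide`). Starting from the last node of a purported refutation and moving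
to premises that do not follow from `s` axioms, one meets a node which is invalid or of medium
complexity. This search is an instance of `Iter`; a step needs the node and one of its premises, so
two blocks (`stepTree`, `stepTree_eval`). Each node gets an extra dead end, so that a solution is
always located at the offending node itself and its index is the answer.

Suppose there are `N` such restrictions `ρ y`, and every clause has medium complexity for at most
`N / (2 * L)` of them. If node `i` has medium complexity for `ρ y`, then `y` is determined by the
clause of node `i` and a number below `N / (2 * L)`; hence `g` can name `y` by one of
`M ≤ N / 2` codes and `f` can decode it by reading that clause. So a solution of the instance of
`rwPHP(PLS)` is never a node of medium complexity, and is therefore an invalid node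
(`reducesToRwPHPPLS_of_medium_count`).

The restrictions come from choosing one variable and its value in each interval of `q` variables,
there being at most `2 ^ n` choices, and unsetting the variables of all axioms in which two
variables were chosen. Each axiom then loses at most one variable, which an expanding formula
tolerates (`VarExpanding.boundaryExpanding`). Only about `1 / q ^ 2` of the axioms are hit twice
(`card_selection_le_two_mul_card`), while a clause with more than `s` variables has at most
`τ` selected literals, `τ` a small multiple of `s / q`, with exponentially small probability
(`card_selLit_le_le`). So if `q` is a large constant, a wide clause remains untouched by an
exponentially small fraction of the restrictions.

Finally, a random CNF is expanding and unsatisfiable with failure probability `O(1 / n ^ 2)`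
(`real_randomKCNF_not_typical_le`), by union bounds, where unsatisfiability uses that
`0.7 > log 2`. The Borel–Cantelli lemma concludes. The clause width `k = 8` is enough: expansion is
needed only up to a loss of three variables per axiom, which leaves at least two boundary variables
per axiom, one of which may be set.
-/

noncomputable section

namespace ResRefuter

/-! ### Restrictions, implication from few axioms, and width -/

/-- The variables occurring in a clause, with either sign. -/
def Clause.vars {n : ℕ} (C : Clause n) : Finset (Fin n) := C.image Prod.fst

lemma Clause.mem_vars {n : ℕ} {C : Clause n} {v : Fin n} :
    v ∈ C.vars ↔ ∃ b, (v, b) ∈ C := by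
  simp [Clause.vars]

/-- A restriction: a partial assignment, `none` marking the variables left unset. -/
abbrev Restriction (n : ℕ) : Type := Fin n → Option Bool

/-- The total assignment `α` agrees with `ρ` wherever `ρ` is defined. -/
def Restriction.Extends {n : ℕ} (ρ : Restriction n) (α : Fin n → Bool) : Prop :=
  ∀ v b, ρ v = some b → α v = b

/-- Under the restriction `ρ`, the clause `C` follows semantically from at most `s` clauses
of `F`. -/
def Implied {n m : ℕ} (F : CNF n m) (ρ : Restriction n) (s : ℕ) (C : Clause n) : Prop :=
  ∃ J : Finset (Fin m), J.card ≤ s ∧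
    ∀ α, ρ.Extends α → (∀ i ∈ J, Clause.Sat (F i) α) → Clause.Sat C α

/-- A clause of medium complexity: it follows from `2 * s` clauses of `F`, but not from `s`. -/
def Medium {n m : ℕ} (F : CNF n m) (ρ : Restriction n) (s : ℕ) (C : Clause n) : Prop :=
  ¬ Implied F ρ s C ∧ Implied F ρ (2 * s) C

/-- The boundary of a set `J` of clauses of `F`: the variables that occur in exactly one of
them. -/
def boundary {n m : ℕ} (F : CNF n m) (J : Finset (Fin m)) : Finset (Fin n) :=
  {v | ∃ i ∈ J, v ∈ (F i).vars ∧ ∀ j ∈ J, j ≠ i → v ∉ (F j).vars}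

/-- Every set of at most `r` clauses of `F` has at least as many boundary variables left unset
by `ρ` as it has members. -/
def BoundaryExpanding {n m : ℕ} (F : CNF n m) (ρ : Restriction n) (r : ℕ) : Prop :=
  ∀ J : Finset (Fin m), J.card ≤ r → J.card ≤ {v ∈ boundary F J | ρ v = none}.card

section Width

variable {n m : ℕ} {F : CNF n m} {ρ : Restriction n}

lemma Implied.mono {s t : ℕ} {C : Clause n} (h : Implied F ρ s C) (hst : s ≤ t) :
    Implied F ρ t C := by
  obtain ⟨J, hJ, h⟩ := h
  exact ⟨J, hJ.trans hst, h⟩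

lemma Implied.of_axiom (i : Fin m) {s : ℕ} (hs : 1 ≤ s) : Implied F ρ s (F i) :=
  ⟨{i}, by simpa using hs, fun α _ h => h i (by simp)⟩

lemma Clause.Sat.subset {C D : Clause n} {α : Fin n → Bool} (h : C.Sat α) (hCD : C ⊆ D) :
    D.Sat α := by
  obtain ⟨l, hl, h⟩ := h
  exact ⟨l, hCD hl, h⟩

lemma Implied.weaken {s : ℕ} {C D : Clause n} (h : Implied F ρ s C) (hCD : C ⊆ D) :
    Implied F ρ s D := by
  obtain ⟨J, hJ, h⟩ := h
  exact ⟨J, hJ, fun α h1 h2 => (h α h1 h2).subset hCD⟩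

lemma Implied.resolve {s t : ℕ} {D E : Clause n} {a : Fin n}
    (h : Implied F ρ s (insert (a, true) D)) (h' : Implied F ρ t (insert (a, false) E)) :
    Implied F ρ (s + t) (D ∪ E) := by
  classical
  obtain ⟨J, hJ, h⟩ := h
  obtain ⟨J', hJ', h'⟩ := h'
  refine ⟨J ∪ J', (Finset.card_union_le _ _).trans (add_le_add hJ hJ'), fun α h1 h2 => ?_⟩
  obtain ⟨l, hl, hl'⟩ := h α h1 fun i hi => h2 i (Finset.mem_union_left _ hi)
  obtain ⟨l2, hl2, hl2'⟩ := h' α h1 fun i hi => h2 i (Finset.mem_union_right _ hi)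
  rw [Finset.mem_insert] at hl hl2
  rcases hl with rfl | hl
  · rcases hl2 with rfl | hl2
    · simp_all
    · exact ⟨l2, Finset.mem_union_right _ hl2, hl2'⟩
  · exact ⟨l, Finset.mem_union_left _ hl, hl'⟩

/-- An assignment that falsifies only the clause `i` of `J` is repaired by flipping a boundary
variable of `i`. -/
lemma sat_of_flip {J : Finset (Fin m)} {i : Fin m} {v : Fin n} {α : Fin n → Bool}
    (hv : v ∈ (F i).vars) (hvJ : ∀ j ∈ J, j ≠ i → v ∉ (F j).vars)
    (hα : ∀ j ∈ J, j ≠ i → (F j).Sat α) (hi : ¬ (F i).Sat α) :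
    ∀ j ∈ J, (F j).Sat (Function.update α v (!α v)) := by
  intro j hj
  by_cases hji : j = i
  · subst hji
    obtain ⟨b, hb⟩ := Clause.mem_vars.1 hv
    refine ⟨(v, b), hb, ?_⟩
    have : α v ≠ b := fun h => hi ⟨(v, b), hb, h⟩
    simp only [Function.update_self]
    revert this
    cases α v <;> cases b <;> simp
  · obtain ⟨l, hl, hl'⟩ := hα j hj hji
    refine ⟨l, hl, ?_⟩
    rw [Function.update_of_ne, hl']
    rintro rfl
    exact hvJ j hj hji (Clause.mem_vars.2 ⟨_, hl⟩)

lemma Restriction.Extends.update {α : Fin n → Bool} (h : ρ.Extends α) {v : Fin n}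
    (hv : ρ v = none) (b : Bool) : ρ.Extends (Function.update α v b) := by
  intro w c hw
  rw [Function.update_of_ne, h w c hw]
  rintro rfl
  simp [hv] at hw

lemma BoundaryExpanding.exists_sat {r : ℕ} (h : BoundaryExpanding F ρ r) (J : Finset (Fin m))
    (hJ : J.card ≤ r) : ∃ α, ρ.Extends α ∧ ∀ i ∈ J, (F i).Sat α := by
  classical
  induction hk : J.card generalizing J with
  | zero =>
    rw [Finset.card_eq_zero] at hk
    subst hk
    exact ⟨fun v => (ρ v).getD false, fun v b hb => by simp [hb], by simp⟩
  | succ c ih =>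
    have hpos : 0 < {v ∈ boundary F J | ρ v = none}.card := by have := h J hJ; omega
    obtain ⟨v, hv⟩ := Finset.card_pos.1 hpos
    simp only [boundary, Finset.mem_filter, Finset.mem_univ, true_and] at hv
    obtain ⟨⟨i, hi, hvi, hvJ⟩, hρ⟩ := hv
    have hc : (J.erase i).card = c := by rw [Finset.card_erase_of_mem hi]; omega
    obtain ⟨α, hα, hs⟩ := ih (J.erase i) (by omega) hc
    by_cases hsi : (F i).Sat α
    · refine ⟨α, hα, fun j hj => ?_⟩
      by_cases hji : j = i
      · exact hji ▸ hsi
      · exact hs j (Finset.mem_erase.2 ⟨hji, hj⟩)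
    · exact ⟨_, hα.update hρ _,
        sat_of_flip hvi hvJ (fun j hj hji => hs j (Finset.mem_erase.2 ⟨hji, hj⟩)) hsi⟩

lemma BoundaryExpanding.not_implied_empty {r : ℕ} (h : BoundaryExpanding F ρ r) :
    ¬ Implied F ρ r ∅ := by
  rintro ⟨J, hJ, hJ'⟩
  obtain ⟨α, hα, hs⟩ := h.exists_sat J hJ
  obtain ⟨l, hl, -⟩ := hJ' α hα hs
  simp at hl

/-- In a minimal set of clauses implying `C`, every unset boundary variable must occur in `C`, for
otherwise flipping it would give a counterexample to the implication. -/
lemma Medium.wide {s : ℕ} {C : Clause n} (hF : BoundaryExpanding F ρ (2 * s))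
    (hC : Medium F ρ s C) :
    s < C.vars.card ∧ ∀ l ∈ C, ρ l.1 ≠ some l.2 := by
  classical
  obtain ⟨hC1, hC2⟩ := hC
  have hex : ∃ j, Implied F ρ j C := ⟨_, hC2⟩
  set r := Nat.find hex with hr
  obtain ⟨J, hJr, hJ⟩ : Implied F ρ r C := Nat.find_spec hex
  have hr2 : r ≤ 2 * s := Nat.find_min' hex hC2
  have hsr : s < r := by
    by_contra hcon
    exact hC1 (Implied.mono ⟨J, hJr, hJ⟩ (not_lt.1 hcon))
  have hJc : J.card = r := le_antisymm hJr (Nat.find_min' hex ⟨J, le_rfl, hJ⟩)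
  have key : ∀ i ∈ J, ∃ α, ρ.Extends α ∧ (∀ j ∈ J, j ≠ i → (F j).Sat α) ∧ ¬ C.Sat α := by
    intro i hi
    by_contra hcon
    push Not at hcon
    have hlt : (J.erase i).card < r := by
      rw [Finset.card_erase_of_mem hi]
      omega
    exact Nat.find_min hex hlt ⟨J.erase i, le_rfl, fun α h1 h2 =>
      hcon α h1 fun j hj hji => h2 j (Finset.mem_erase.2 ⟨hji, hj⟩)⟩
  constructor
  · have hsub : {v ∈ boundary F J | ρ v = none} ⊆ C.vars := by
      intro v hv
      simp only [boundary, Finset.mem_filter, Finset.mem_univ, true_and] at hv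
      obtain ⟨⟨i, hi, hvi, hvJ⟩, hρ⟩ := hv
      obtain ⟨α, hα, hs, hCα⟩ := key i hi
      have hsi : ¬ (F i).Sat α := fun hsi => hCα <| hJ α hα fun j hj => by
        by_cases hji : j = i
        · exact hji ▸ hsi
        · exact hs j hj hji
      obtain ⟨l, hl, hl'⟩ := hJ _ (hα.update hρ (!α v)) (sat_of_flip hvi hvJ hs hsi)
      by_cases hlv : l.1 = v
      · exact Clause.mem_vars.2 ⟨l.2, by rw [← hlv]; exact hl⟩
      · rw [Function.update_of_ne hlv] at hl'
        exact absurd ⟨l, hl, hl'⟩ hCα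
    have h1 := hF J (by omega)
    have h2 := Finset.card_le_card hsub
    omega
  · intro l hl hρl
    obtain ⟨i, hi⟩ : J.Nonempty := Finset.card_pos.1 (by omega)
    obtain ⟨α, hα, -, hCα⟩ := key i hi
    exact hCα ⟨l, hl, hα _ _ hρl⟩

end Width

/-! ### The reduction -/

section Reduction

variable {n m L : ℕ}

/-- The position `2 * (L - 1 - i)` of `Iter` at which node `i` is inspected. Positions grow as
premises are followed, the last node being at position `0`. The odd position after it is a
dead end, entered when the search stops at node `i`. -/
def pos (i : Fin L) : Fin (2 * L) := ⟨2 * (L - 1 - i), by have := i.2; omega⟩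

/-- The dead end next to `pos i`. -/
def deadEnd (i : Fin L) : Fin (2 * L) := ⟨2 * (L - 1 - i) + 1, by have := i.2; omega⟩

/-- The node inspected at a position. -/
def nodeAt (x : Fin (2 * L)) : Fin L := ⟨L - 1 - x / 2, by have := x.2; omega⟩

lemma eq_pos_or_eq_deadEnd (x : Fin (2 * L)) :
    x = pos (nodeAt x) ∨ x = deadEnd (nodeAt x) := by
  have := x.2
  simp only [pos, deadEnd, nodeAt, Fin.ext_iff]
  omega

@[simp] lemma nodeAt_pos (i : Fin L) : nodeAt (pos i) = i := by
  have := i.2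
  simp only [pos, nodeAt, Fin.ext_iff]
  omega

lemma deadEnd_val_odd (i : Fin L) : (deadEnd i : ℕ) % 2 = 1 := by
  simp only [deadEnd]
  omega

lemma pos_val_even (i : Fin L) : (pos i : ℕ) % 2 = 0 := by
  simp only [pos]
  omega

lemma pos_ne_deadEnd (i j : Fin L) : pos i ≠ deadEnd j := by
  simp only [pos, deadEnd, ne_eq, Fin.ext_iff]
  omega

lemma pos_lt_pos {i j : Fin L} (h : j < i) : pos i < pos j := by
  have := i.2
  have : (j : ℕ) < i := h
  simp only [pos, Fin.lt_def]
  omega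

variable (F : CNF n m) (ρ : Restriction n) (s : ℕ)

/-- The move from node `i` to its premise: an axiom ends the search. -/
def moveTo (i : Fin L) : Premise m L → Fin (2 * L)
  | .inl _ => deadEnd i
  | .inr j => pos j

open Classical in
/-- The tree computing the step of the search from node `i`. Node `i` is left where it is if it is
implied by `s` axioms, the search ends there if its clause is of medium complexity, and otherwise
it continues to a premise which is not implied by `s` axioms. -/
def stepTree (i : Fin L) : BlockTree (refuter F L) (Fin (2 * L)) :=
  .query (P := refuter F L) i fun v : Node n m L =>
    if Implied F ρ s v.1 then .leaf (pos i)
    else if Implied F ρ (2 * s) v.1 then .leaf (deadEnd i)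
    else match v.2 with
      | .inr j => if Premise.Before i j then .leaf (moveTo i j) else .leaf (deadEnd i)
      | .inl (j, k, _) =>
        if Premise.Before i j ∧ Premise.Before i k then
          match j with
          | .inl _ => .leaf (moveTo i k)
          | .inr j => .query (P := refuter F L) j fun w : Node n m L =>
              if Implied F ρ s w.1 then .leaf (moveTo i k) else .leaf (pos j)
        else .leaf (deadEnd i)

open Classical in
/-- The tree computing the value at position `x` of the instance of `Iter` which belongs to the
restriction `ρ`. -/
def iterTree (x : Fin (2 * L)) : BlockTree (refuter F L) (Fin (2 * L)) :=
  if (x : ℕ) % 2 = 0 then stepTree F ρ s (nodeAt x) else .leaf x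

lemma stepTree_depth (i : Fin L) : (stepTree F ρ s i).DepthLE 2 := by
  intro v
  dsimp only
  split_ifs
  · trivial
  · trivial
  · split
    · split_ifs <;> trivial
    · split_ifs
      · split
        · trivial
        · intro w
          dsimp only
          split_ifs <;> trivial
      · trivial

lemma iterTree_depth (x : Fin (2 * L)) : (iterTree F ρ s x).DepthLE 2 := by
  unfold iterTree
  split_ifs
  · exact stepTree_depth F ρ s _
  · trivial

variable {F ρ s}

lemma ValidStep.implied_of_weakening {p : Fin L → Node n m L} {i : Fin L} {j : Premise m L}
    (h : ValidStep F p i) (ht : (p i).2 = .inr j) {t : ℕ}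
    (hj : Implied F ρ t (premiseClause F p j)) : Implied F ρ t (p i).1 := by
  unfold ValidStep at h
  rw [ht] at h
  obtain ⟨-, D, hD⟩ := h
  rw [hD]
  exact hj.weaken Finset.subset_union_left

lemma ValidStep.implied_of_resolution {p : Fin L → Node n m L} {i : Fin L} {j k : Premise m L}
    {a : Fin n} (h : ValidStep F p i) (ht : (p i).2 = .inl (j, k, a)) {t : ℕ}
    (hj : Implied F ρ t (premiseClause F p j)) (hk : Implied F ρ t (premiseClause F p k)) :
    Implied F ρ (2 * t) (p i).1 := by
  unfold ValidStep at h
  rw [ht] at h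
  obtain ⟨-, -, D, E, hD, hE, hDE⟩ := h
  rw [hDE, two_mul]
  rw [hD] at hj
  rw [hE] at hk
  exact hj.resolve hk

/-- What one step of the search from node `i` can do. A step to an implied clause, or into the dead
end at a node that is not of medium complexity, exposes node `i` as invalid. -/
lemma stepTree_eval (hs : 1 ≤ s) (p : Fin L → Node n m L) (i : Fin L) :
    (Implied F ρ s (p i).1 ∧ (stepTree F ρ s i).eval p = pos i) ∨
    ((stepTree F ρ s i).eval p = deadEnd i ∧ (Medium F ρ s (p i).1 ∨ ¬ ValidStep F p i)) ∨
    ∃ j < i, (stepTree F ρ s i).eval p = pos j ∧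
      (Implied F ρ s (p j).1 → ¬ ValidStep F p i) := by
  classical
  by_cases h1 : Implied F ρ s (p i).1
  · left
    exact ⟨h1, by simp [stepTree, BlockTree.eval, h1]⟩
  by_cases h2 : Implied F ρ (2 * s) (p i).1
  · right; left
    exact ⟨by simp [stepTree, BlockTree.eval, h1, h2], .inl ⟨h1, h2⟩⟩
  right
  rcases ht : (p i).2 with ⟨j, k, a⟩ | j
  · by_cases hb : Premise.Before i j ∧ Premise.Before i k
    · -- the move to the premise `k`, made when `j` is implied by `s` axioms
      have hk : Implied F ρ s (premiseClause F p j) →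
          (stepTree F ρ s i).eval p = moveTo i k →
          ((stepTree F ρ s i).eval p = deadEnd i ∧
            (Medium F ρ s (p i).1 ∨ ¬ ValidStep F p i)) ∨
          ∃ j < i, (stepTree F ρ s i).eval p = pos j ∧
            (Implied F ρ s (p j).1 → ¬ ValidStep F p i) := by
        intro hj he
        rcases k with k | k
        · exact .inl ⟨he, .inr fun hv =>
            h2 (hv.implied_of_resolution ht hj (Implied.of_axiom k hs))⟩
        · exact .inr ⟨k, hb.2, he, fun hkI hv => h2 (hv.implied_of_resolution ht hj hkI)⟩
      rcases j with j | j
      · exact hk (Implied.of_axiom j hs) (by simp [stepTree, BlockTree.eval, h1, h2, ht, hb])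
      · by_cases hj : Implied F ρ s (p j).1
        · exact hk hj (by simp [stepTree, BlockTree.eval, h1, h2, ht, hb, hj])
        · exact .inr ⟨j, hb.1, by simp [stepTree, BlockTree.eval, h1, h2, ht, hb, hj],
            fun h => absurd h hj⟩
    · left
      refine ⟨by simp [stepTree, BlockTree.eval, h1, h2, ht, hb], .inr fun hv => hb ?_⟩
      unfold ValidStep at hv
      rw [ht] at hv
      exact ⟨hv.1, hv.2.1⟩
  · by_cases hb : Premise.Before i j
    · rcases j with j | j
      · left
        refine ⟨by simp [stepTree, BlockTree.eval, h1, h2, ht, hb, moveTo], .inr fun hv => h1 ?_⟩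
        exact hv.implied_of_weakening ht (Implied.of_axiom j hs)
      · right
        exact ⟨j, hb, by simp [stepTree, BlockTree.eval, h1, h2, ht, hb, moveTo],
          fun h hv => h1 (hv.implied_of_weakening ht h)⟩
    · left
      refine ⟨by simp [stepTree, BlockTree.eval, h1, h2, ht, hb], .inr fun hv => hb ?_⟩
      unfold ValidStep at hv
      rw [ht] at hv
      exact hv.1

/-- A solution of the instance of `Iter` belonging to `ρ` points to a node which is invalid or of
medium complexity. -/
lemma medium_or_not_validNode_of_isSol (hs : 1 ≤ s) (hroot : ¬ Implied F ρ (2 * s) ∅)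
    (p : Fin L → Node n m L) (x : Fin (2 * L))
    (hx : (iter (2 * L)).IsSol (fun z => (iterTree F ρ s z).eval p) x) :
    Medium F ρ s (p (nodeAt x)).1 ∨ ¬ ValidNode F p (nodeAt x) := by
  have hdead : ∀ i : Fin L, (iterTree F ρ s (deadEnd i)).eval p = deadEnd i := by
    intro i
    simp [iterTree, deadEnd_val_odd, BlockTree.eval]
  have hpos : ∀ i : Fin L,
      (iterTree F ρ s (pos i)).eval p = (stepTree F ρ s i).eval p := by
    intro i
    simp [iterTree, pos_val_even]
  change (((x : ℕ) = 0 ∧ (iterTree F ρ s x).eval p = x) ∨ (iterTree F ρ s x).eval p < x ∨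
    (x < (iterTree F ρ s x).eval p ∧
      (iterTree F ρ s ((iterTree F ρ s x).eval p)).eval p = (iterTree F ρ s x).eval p)) at hx
  generalize hi : nodeAt x = i
  rcases eq_pos_or_eq_deadEnd x with hxi | hxi <;> rw [hi] at hxi <;> subst hxi
  · rw [hpos] at hx
    rcases stepTree_eval (ρ := ρ) (F := F) hs p i with ⟨h1, h2⟩ | ⟨h1, h2⟩ | ⟨j, hj, h1, h2⟩
    · -- only the last node can be a solution without moving, and its clause is not empty
      rw [h2] at hx
      simp only [lt_self_iff_false, false_and, or_false, and_true] at hx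
      right
      rintro ⟨-, hv⟩
      have : (i : ℕ) + 1 = L := by
        have := i.2
        simp only [pos] at hx
        omega
      rw [hv this] at h1
      exact hroot (h1.mono (by omega))
    · exact h2.imp id fun h hv => h hv.1
    · rw [h1, hpos] at hx
      have hlt := pos_lt_pos hj
      have hself : (stepTree F ρ s j).eval p = pos j := by
        rcases hx with h | h | h
        · exact absurd h.2 hlt.ne'
        · exact absurd h hlt.asymm
        · exact h.2
      right
      rintro ⟨hv, -⟩
      rcases stepTree_eval (ρ := ρ) (F := F) hs p j with ⟨h3, -⟩ | ⟨h3, -⟩ | ⟨k, hk, h3, -⟩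
      · exact h2 h3 hv
      · exact absurd (hself.symm.trans h3) (pos_ne_deadEnd _ _)
      · exact absurd (hself.symm.trans h3) (pos_lt_pos hk).ne
  · rw [hdead] at hx
    have h0 : ((deadEnd i : Fin (2 * L)) : ℕ) ≠ 0 := by simp [deadEnd]
    simp [h0] at hx

/-- A finite set with at most `B` elements injects into `Fin B`. -/
lemma exists_encoding {α : Type*} (T : Set α) [Finite α] {B : ℕ} (hB : 1 ≤ B)
    (hT : T.ncard ≤ B) :
    ∃ enc : α → Fin B, Set.InjOn enc T := by
  classical
  have := Fintype.ofFinite α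
  have hle : Fintype.card T ≤ Fintype.card (Fin B) := by
    rw [Fintype.card_fin, ← Nat.card_eq_fintype_card]
    exact hT
  obtain ⟨e⟩ := Function.Embedding.nonempty_of_card_le hle
  refine ⟨fun a => if h : a ∈ T then e ⟨a, h⟩ else ⟨0, hB⟩, fun a ha b hb hab => ?_⟩
  simpa [ha, hb] using hab

/-- The reduction. A solution `(y, x)` of the instance is mapped to the node at `x`. If that node is
of medium complexity under `ρ y`, then `y` is one of at most `B` such indices for its clause, and
is recovered by `f` from the node and a number below `B`. -/
theorem reducesToRwPHPPLS_of_medium_count {N B : ℕ} (F : CNF n m) (ρ : Fin N → Restriction n)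
    (hL : 1 ≤ L) (hB : 1 ≤ B) (hN : 2 * (L * B) ≤ N) (hs : 1 ≤ s)
    (hroot : ∀ y, ¬ Implied F (ρ y) (2 * s) ∅)
    (hcount : ∀ C, {y | Medium F (ρ y) s C}.ncard ≤ B)
    (hsize : (rwPHP (iter (2 * L)) (L * B) N).bitLength ≤ 2 ^ (2 * (refuter F L).blockBits)) :
    ReducesToRwPHPPLS (refuter F L) 2 := by
  classical
  choose enc henc using fun C => exists_encoding {y | Medium F (ρ y) s C} hB (hcount C)
  have hN0 : 0 < N := by nlinarith
  -- the index with code `e` for the clause `C`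
  let dec : Clause n → Fin B → Fin N := fun C e =>
    if h : ∃ y, Medium F (ρ y) s C ∧ enc C y = e then h.choose else ⟨0, hN0⟩
  have hdec : ∀ C y, Medium F (ρ y) s C → dec C (enc C y) = y := by
    intro C y hy
    have h : ∃ y', Medium F (ρ y') s C ∧ enc C y' = enc C y := ⟨y, hy, rfl⟩
    simp only [dec, dif_pos h]
    exact henc C h.choose_spec.1 hy h.choose_spec.2
  refine ⟨L * B, N, 2 * L, Nat.mul_pos hL hB, hN, by omega, ⟨?_⟩⟩
  exact
    { inst := fun b => match b with
        | .f z => .query (P := refuter F L) (finProdFinEquiv.symm z).1 fun v : Node n m L =>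
            .leaf (dec v.1 (finProdFinEquiv.symm z).2)
        | .inst y x => iterTree F (ρ y) s x
        | .g y x => .query (P := refuter F L) (nodeAt x) fun v : Node n m L =>
            .leaf (finProdFinEquiv (nodeAt x, enc v.1 y))
      sol := fun o => .leaf (nodeAt o.2)
      inst_depth := by
        rintro (z | ⟨y, x⟩ | ⟨y, x⟩)
        · intro v; trivial
        · exact iterTree_depth F (ρ y) s x
        · intro v; trivial
      sol_depth := fun o => trivial
      correct := by
        rintro p ⟨y, x⟩ ⟨h1, h2⟩
        rcases medium_or_not_validNode_of_isSol hs (hroot y) p x h1 with h | h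
        · refine absurd ?_ h2
          change dec (p (finProdFinEquiv.symm (finProdFinEquiv
            (nodeAt x, enc (p (nodeAt x)).1 y))).1).1 (finProdFinEquiv.symm (finProdFinEquiv
            (nodeAt x, enc (p (nodeAt x)).1 y))).2 = y
          rw [Equiv.symm_apply_apply]
          exact hdec _ _ h
        · exact h
      size_le := hsize }

end Reduction


/-! ### The size of the instance -/

lemma bitLength_rwPHP_le (K M N : ℕ) :
    (rwPHP (iter K) M N).bitLength ≤ M * N + N * K * K + N * K * M := by
  have hclog : ∀ a : ℕ, Nat.clog 2 a ≤ a := fun a =>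
    Nat.clog_le_of_le_pow Nat.lt_two_pow_self.le
  unfold SearchProblem.bitLength
  have h : ∑ b : (rwPHP (iter K) M N).Block, (rwPHP (iter K) M N).bits b =
      ∑ b : Fin M ⊕ (Fin N × Fin K) ⊕ (Fin N × Fin K),
        (rwPHP (iter K) M N).bits (RwBlock.equivSum (iter K) M N b) :=
    (Equiv.sum_comp (RwBlock.equivSum (iter K) M N) _).symm
  rw [h, Fintype.sum_sum_type, Fintype.sum_sum_type, ← add_assoc]
  refine add_le_add (add_le_add ?_ ?_) ?_
  · refine (Finset.sum_le_card_nsmul _ _ N fun z _ => ?_).trans (by simp)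
    change Nat.clog 2 (Nat.card (Fin N)) ≤ N
    simpa using hclog N
  · refine (Finset.sum_le_card_nsmul _ _ K fun z _ => ?_).trans (by simp)
    change Nat.clog 2 (Nat.card (Fin K)) ≤ K
    simpa using hclog K
  · refine (Finset.sum_le_card_nsmul _ _ M fun z _ => ?_).trans (by simp)
    change Nat.clog 2 (Nat.card (Fin M)) ≤ M
    simpa using hclog M

lemma le_two_pow_blockBits_refuter {n m L : ℕ} (F : CNF n m) (hL : 1 ≤ L) :
    2 ^ (2 * n) * L ≤ 2 ^ (refuter F L).blockBits := by
  have h1 : (refuter F L).bits (⟨0, hL⟩ : Fin L) ≤ (refuter F L).blockBits :=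
    Finset.le_sup (f := (refuter F L).bits) (Finset.mem_univ _)
  have h2 : Nat.card (Node n m L) ≤ 2 ^ (refuter F L).bits (⟨0, hL⟩ : Fin L) :=
    Nat.le_pow_clog (by norm_num) _
  refine le_trans ?_ (h2.trans (Nat.pow_le_pow_right (by norm_num) h1))
  rw [Nat.card_eq_fintype_card, Fintype.card_prod, Fintype.card_finset]
  simp only [Fintype.card_prod, Fintype.card_sum, Fintype.card_fin, Fintype.card_bool]
  rw [mul_comm n 2]
  exact Nat.mul_le_mul_left _ (by omega)

lemma bitLength_rwPHP_le_blockBits {n m L M N : ℕ} (F : CNF n m) (hL : 1 ≤ L) (hM : 1 ≤ M)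
    (hMN : 2 * M ≤ N) (hN : N ≤ 2 ^ n) :
    (rwPHP (iter (2 * L)) M N).bitLength ≤ 2 ^ (2 * (refuter F L).blockBits) := by
  have h1 := le_two_pow_blockBits_refuter F hL
  have hn : 1 ≤ n := by
    by_contra hcon
    have : n = 0 := by omega
    subst this
    simp at hN
    omega
  calc (rwPHP (iter (2 * L)) M N).bitLength
      ≤ M * N + N * (2 * L) * (2 * L) + N * (2 * L) * M := bitLength_rwPHP_le _ _ _
    _ ≤ 4 * (N * L) ^ 2 := by
        have a1 : M * N ≤ N * N * (L * L) := by
          have : 1 ≤ L * L := Nat.mul_pos hL hL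
          nlinarith [Nat.zero_le (N * N), Nat.zero_le M]
        have a2 : N * (2 * L) * (2 * L) ≤ 2 * (N * N * (L * L)) := by
          have : 2 ≤ N := by omega
          have : N * 2 * (L * L) ≤ N * N * (L * L) := by gcongr
          linarith
        have a3 : N * (2 * L) * M ≤ N * N * (L * L) := by
          calc N * (2 * L) * M = N * L * (2 * M) := by ring
            _ ≤ N * L * N := by gcongr
            _ = N * N * L := by ring
            _ ≤ N * N * (L * L) := by gcongr; nlinarith
        nlinarith
    _ ≤ 4 * (2 ^ n * L) ^ 2 := by gcongr
    _ ≤ (2 ^ (2 * n) * L) ^ 2 := by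
        have h4 : 4 ≤ (2 ^ n) ^ 2 := by
          calc 4 = (2 ^ 1) ^ 2 := by norm_num
            _ ≤ (2 ^ n) ^ 2 := by gcongr; norm_num
        calc 4 * (2 ^ n * L) ^ 2 ≤ (2 ^ n) ^ 2 * (2 ^ n * L) ^ 2 := by gcongr
          _ = (2 ^ (2 * n) * L) ^ 2 := by ring
    _ ≤ (2 ^ (refuter F L).blockBits) ^ 2 := by gcongr
    _ = 2 ^ (2 * (refuter F L).blockBits) := by rw [← pow_mul, mul_comm]

/-! ### Expansion -/

/-- The variables occurring in a set of clauses of `F`. -/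
def varsOf {n m : ℕ} (F : CNF n m) (J : Finset (Fin m)) : Finset (Fin n) :=
  J.biUnion fun i => (F i).vars

/-- Sets of at most `r` clauses contain at most `a` variables per clause fewer than if their
clauses were disjoint and of width `k`. -/
def VarExpanding {n m : ℕ} (F : CNF n m) (k a r : ℕ) : Prop :=
  ∀ J : Finset (Fin m), J.card ≤ r → (k - a) * J.card ≤ (varsOf F J).card

/-- Every variable of `J` off the boundary is counted at least twice in the sum of the widths. -/
lemma two_mul_card_varsOf_le {n m k : ℕ} {F : CNF n m} (hF : ∀ i, (F i).vars.card ≤ k)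
    (J : Finset (Fin m)) :
    2 * (varsOf F J).card ≤ k * J.card + (boundary F J).card := by
  classical
  have hsum : ∑ v ∈ varsOf F J, {i ∈ J | v ∈ (F i).vars}.card ≤ k * J.card := by
    calc ∑ v ∈ varsOf F J, {i ∈ J | v ∈ (F i).vars}.card
        = ∑ i ∈ J, {v ∈ varsOf F J | v ∈ (F i).vars}.card :=
          Finset.sum_card_bipartiteAbove_eq_sum_card_bipartiteBelow _
      _ ≤ ∑ i ∈ J, k := Finset.sum_le_sum fun i _ =>
          (Finset.card_le_card fun v hv => (Finset.mem_filter.1 hv).2).trans (hF i)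
      _ = k * J.card := by rw [Finset.sum_const, smul_eq_mul, mul_comm]
  have hpt : ∀ v ∈ varsOf F J,
      2 ≤ {i ∈ J | v ∈ (F i).vars}.card + if v ∈ boundary F J then 1 else 0 := by
    intro v hv
    obtain ⟨i, hi, hvi⟩ := Finset.mem_biUnion.1 hv
    have hpos : 1 ≤ {i ∈ J | v ∈ (F i).vars}.card :=
      Finset.card_pos.2 ⟨i, Finset.mem_filter.2 ⟨hi, hvi⟩⟩
    split_ifs with hb
    · omega
    · by_contra hcon
      have h1 : {i ∈ J | v ∈ (F i).vars}.card = 1 := by omega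
      obtain ⟨i', hi'⟩ := Finset.card_eq_one.1 h1
      apply hb
      simp only [boundary, Finset.mem_filter, Finset.mem_univ, true_and]
      refine ⟨i, hi, hvi, fun j hj hji hvj => hji ?_⟩
      have e1 : i ∈ ({i'} : Finset _) := hi' ▸ Finset.mem_filter.2 ⟨hi, hvi⟩
      have e2 : j ∈ ({i'} : Finset _) := hi' ▸ Finset.mem_filter.2 ⟨hj, hvj⟩
      rw [Finset.mem_singleton] at e1 e2
      rw [e1, e2]
  have h2 : 2 * (varsOf F J).card ≤ ∑ v ∈ varsOf F J,
      ({i ∈ J | v ∈ (F i).vars}.card + if v ∈ boundary F J then 1 else 0) := by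
    rw [mul_comm, ← smul_eq_mul]
    exact Finset.card_nsmul_le_sum _ _ _ hpt
  rw [Finset.sum_add_distrib, ← Finset.card_filter] at h2
  have h3 : {v ∈ varsOf F J | v ∈ boundary F J}.card ≤ (boundary F J).card :=
    Finset.card_le_card fun v hv => (Finset.mem_filter.1 hv).2
  omega

lemma VarExpanding.boundaryExpanding {n m k r : ℕ} {F : CNF n m} (hk : 8 ≤ k)
    (hF : ∀ i, (F i).vars.card ≤ k) (h : VarExpanding F k 3 r) {ρ : Restriction n}
    (hρ : ∀ i, {v ∈ (F i).vars | ρ v ≠ none}.card ≤ 1) : BoundaryExpanding F ρ r := by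
  classical
  intro J hJ
  have h1 := two_mul_card_varsOf_le hF J
  have h2 := h J hJ
  have h3 : {v ∈ boundary F J | ρ v ≠ none}.card ≤ J.card := by
    have hsub : {v ∈ boundary F J | ρ v ≠ none} ⊆
        J.biUnion fun i => {v ∈ (F i).vars | ρ v ≠ none} := by
      intro v hv
      simp only [boundary, Finset.mem_filter, Finset.mem_univ, true_and] at hv
      obtain ⟨⟨i, hi, hvi, -⟩, hv⟩ := hv
      exact Finset.mem_biUnion.2 ⟨i, hi, Finset.mem_filter.2 ⟨hvi, hv⟩⟩
    refine (Finset.card_le_card hsub).trans ?_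
    simpa using Finset.card_biUnion_le_card_mul J
      (fun i => {v ∈ (F i).vars | ρ v ≠ none}) 1 fun i _ => hρ i
  have h4 := Finset.card_filter_add_card_filter_not (s := boundary F J) (fun v => ρ v = none)
  obtain ⟨k, rfl⟩ : ∃ k', k = k' + 8 := ⟨k - 8, by omega⟩
  have h5 : k + 8 - 3 = k + 5 := by omega
  rw [h5] at h2
  have h6 : 0 ≤ k * J.card := Nat.zero_le _
  simp only [ne_eq] at h3
  nlinarith

/-! ### Restrictions that set one variable in each interval of length `q` -/

section Restrictions

variable {n m q : ℕ}

/-- A choice of one variable, and of a value for it, in each of the `n / q` intervals of length `q`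
into which the variables are divided. The last `n % q` variables are never chosen. -/
abbrev Selection (n q : ℕ) : Type := Fin (n / q) → Fin q × Bool

/-- The variable number `a` of the interval `t`. -/
def intervalVar (t : Fin (n / q)) (a : Fin q) : Fin n :=
  ⟨t * q + a, by
    have h1 : ((t : ℕ) + 1) * q ≤ n / q * q := Nat.mul_le_mul_right _ t.2
    have h2 := Nat.div_mul_le_self n q
    have h3 := a.2
    rw [add_mul] at h1
    omega⟩

/-- The literal made true by the selection in the interval `t`. -/
def selLit (ω : Selection n q) (t : Fin (n / q)) : Literal n :=
  (intervalVar t (ω t).1, (ω t).2)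

/-- The intervals in which the selected literal belongs to `C`. -/
def hits (ω : Selection n q) (C : Clause n) : Finset (Fin (n / q)) := {t | selLit ω t ∈ C}

/-- The choices for the interval `t` that select a literal of `C`. -/
def intervalLits (t : Fin (n / q)) (C : Clause n) : Finset (Fin q × Bool) :=
  {x | (intervalVar t x.1, x.2) ∈ C}

lemma intervalVar_inj {t t' : Fin (n / q)} {a a' : Fin q}
    (h : intervalVar t a = intervalVar t' a') : t = t' ∧ a = a' := by
  have h1 : (t : ℕ) * q + a = t' * q + a' := by simpa [intervalVar] using h
  have hq : 0 < q := a.pos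
  have ht : (t : ℕ) = t' := by
    have h2 := congrArg (· / q) h1
    simp only [mul_comm _ q, Nat.mul_add_div hq, Nat.div_eq_of_lt a.2,
      Nat.div_eq_of_lt a'.2, add_zero] at h2
    exact h2
  rw [ht] at h1
  exact ⟨Fin.ext ht, Fin.ext (by omega)⟩

lemma exists_intervalVar_eq (hq : 0 < q) (v : Fin n) (hv : (v : ℕ) < n / q * q) :
    ∃ t a, intervalVar (q := q) t a = v := by
  refine ⟨⟨v / q, (Nat.div_lt_iff_lt_mul hq).2 hv⟩, ⟨v % q, Nat.mod_lt _ hq⟩, Fin.ext ?_⟩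
  simp only [intervalVar]
  rw [mul_comm]
  exact Nat.div_add_mod _ _

/-- The variables chosen by a selection. -/
def selVars (ω : Selection n q) : Finset (Fin n) :=
  Finset.univ.image fun t => (selLit ω t).1

/-- The variables of those clauses in which at least two variables are chosen. -/
def spoiledVars (F : CNF n m) (ω : Selection n q) : Finset (Fin n) :=
  varsOf F {i | ∃ v ∈ (F i).vars, ∃ w ∈ (F i).vars, v ≠ w ∧ v ∈ selVars ω ∧ w ∈ selVars ω}

open Classical in
/-- The restriction that sets the chosen variables, except the spoiled ones. -/
def selRestriction (F : CNF n m) (ω : Selection n q) : Restriction n := fun v =>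
  if h : (∃ t, (selLit ω t).1 = v) ∧ v ∉ spoiledVars F ω then some (selLit ω h.1.choose).2
  else none

lemma selRestriction_selLit (F : CNF n m) (ω : Selection n q) (t : Fin (n / q))
    (ht : (selLit ω t).1 ∉ spoiledVars F ω) :
    selRestriction F ω (selLit ω t).1 = some (selLit ω t).2 := by
  have h : (∃ t', (selLit ω t').1 = (selLit ω t).1) ∧ (selLit ω t).1 ∉ spoiledVars F ω :=
    ⟨⟨t, rfl⟩, ht⟩
  have h2 : h.1.choose = t := (intervalVar_inj h.1.choose_spec).1
  rw [selRestriction, dif_pos h, h2]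

lemma card_selRestriction_le_one (F : CNF n m) (ω : Selection n q) (i : Fin m) :
    {v ∈ (F i).vars | selRestriction F ω v ≠ none}.card ≤ 1 := by
  classical
  rw [Finset.card_le_one]
  have hset : ∀ v, selRestriction F ω v ≠ none → v ∈ selVars ω ∧ v ∉ spoiledVars F ω := by
    intro v hv
    unfold selRestriction at hv
    split_ifs at hv with h
    · obtain ⟨⟨t, ht⟩, h⟩ := h
      exact ⟨Finset.mem_image.2 ⟨t, Finset.mem_univ _, ht⟩, h⟩
    · exact absurd rfl hv
  intro v hv w hw
  rw [Finset.mem_filter] at hv hw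
  by_contra hvw
  refine (hset v hv.2).2 (Finset.mem_biUnion.2 ⟨i, ?_, hv.1⟩)
  simp only [Finset.mem_filter, Finset.mem_univ, true_and]
  exact ⟨v, hv.1, w, hw.1, hvw, (hset v hv.2).1, (hset w hw.2).1⟩

/-- If no literal of `C` is true, then all literals of `C` selected are over spoiled variables. -/
lemma card_selLit_le_card_spoiledVars (F : CNF n m) (ω : Selection n q) (C : Clause n)
    (hC : ∀ l ∈ C, selRestriction F ω l.1 ≠ some l.2) :
    (hits ω C).card ≤ (spoiledVars F ω).card := by
  classical
  refine Finset.card_le_card_of_injOn (fun t => (selLit ω t).1) ?_ ?_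
  · intro t ht
    simp only [hits, Finset.coe_filter, Finset.mem_univ, true_and, Set.mem_ofPred_eq] at ht
    by_contra hcon
    exact hC _ ht (selRestriction_selLit F ω t hcon)
  · intro t _ t' _ h
    exact (intervalVar_inj h).1

lemma card_selection : Fintype.card (Selection n q) = (2 * q) ^ (n / q) := by
  simp [mul_comm]

/-- Two distinct variables are both chosen with probability at most `1 / q ^ 2`. -/
lemma card_selVars_pair_mul_le (v w : Fin n) (hvw : v ≠ w) :
    (Finset.card {ω : Selection n q | v ∈ selVars ω ∧ w ∈ selVars ω}) * q ^ 2 ≤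
      Fintype.card (Selection n q) := by
  classical
  by_cases hne : ∃ ω : Selection n q, v ∈ selVars ω ∧ w ∈ selVars ω
  · obtain ⟨ω₀, hv, hw⟩ := hne
    simp only [selVars, Finset.mem_image, Finset.mem_univ, true_and] at hv hw
    obtain ⟨t, ht⟩ := hv
    obtain ⟨t', ht'⟩ := hw
    have htt : t ≠ t' := by
      rintro rfl
      exact hvw (ht.symm.trans ht')
    let A : Fin (n / q) → Finset (Fin q × Bool) := fun u =>
      if u = t ∨ u = t' then {(ω₀ u).1} ×ˢ Finset.univ else Finset.univ
    have hsub : (Finset.univ.filter fun ω : Selection n q => v ∈ selVars ω ∧ w ∈ selVars ω) ⊆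
        Fintype.piFinset A := by
      intro ω hω
      simp only [selVars, Finset.mem_filter, Finset.mem_image, Finset.mem_univ, true_and] at hω
      obtain ⟨⟨u, hu⟩, ⟨u', hu'⟩⟩ := hω
      obtain ⟨rfl, h1⟩ := intervalVar_inj (hu.trans ht.symm)
      obtain ⟨rfl, h2⟩ := intervalVar_inj (hu'.trans ht'.symm)
      rw [Fintype.mem_piFinset]
      intro x
      simp only [A]
      split_ifs with hx
      · rw [Finset.mem_product]
        refine ⟨Finset.mem_singleton.2 ?_, Finset.mem_univ _⟩
        rcases hx with rfl | rfl
        · exact h1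
        · exact h2
      · exact Finset.mem_univ _
    have hq2 : q ^ 2 = ∏ u : Fin (n / q), if u = t ∨ u = t' then q else 1 := by
      have : (Finset.univ.filter fun u : Fin (n / q) => u = t ∨ u = t') = {t, t'} := by
        ext u; simp
      rw [Finset.prod_ite, Finset.prod_const, this, Finset.card_pair htt]
      simp
    calc _ ≤ (Fintype.piFinset A).card * q ^ 2 :=
          Nat.mul_le_mul_right _ (Finset.card_le_card hsub)
      _ = Fintype.card (Selection n q) := by
          rw [Fintype.card_piFinset, hq2, ← Finset.prod_mul_distrib, card_selection]
          rw [Finset.prod_congr rfl (g := fun _ => 2 * q)]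
          · simp
          · intro u _
            simp only [A]
            split_ifs
            · simp
            · simp [mul_comm]
  · push Not at hne
    rw [Finset.filter_false_of_mem]
    · simp
    · rintro ω - ⟨h1, h2⟩
      exact hne ω h1 h2

lemma sum_card_spoiledVars_mul_le (F : CNF n m) {k : ℕ} (hF : ∀ i, (F i).vars.card ≤ k) :
    (∑ ω : Selection n q, (spoiledVars F ω).card) * q ^ 2 ≤
      m * k ^ 3 * Fintype.card (Selection n q) := by
  classical
  have h1 : ∀ ω : Selection n q, (spoiledVars F ω).card ≤
      ∑ i, ∑ v ∈ (F i).vars, ∑ w ∈ (F i).vars,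
        if v ≠ w ∧ v ∈ selVars ω ∧ w ∈ selVars ω then k else 0 := by
    intro ω
    refine Finset.card_biUnion_le.trans ?_
    rw [Finset.sum_filter]
    refine Finset.sum_le_sum fun i _ => ?_
    split_ifs with h
    · obtain ⟨v, hv, w, hw, h⟩ := h
      refine (hF i).trans (le_trans ?_
        (Finset.single_le_sum (f := fun v => ∑ w ∈ (F i).vars,
          if v ≠ w ∧ v ∈ selVars ω ∧ w ∈ selVars ω then k else 0)
          (fun _ _ => Nat.zero_le _) hv))
      refine le_trans ?_ (Finset.single_le_sum (f := fun w =>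
          if v ≠ w ∧ v ∈ selVars ω ∧ w ∈ selVars ω then k else 0)
          (fun _ _ => Nat.zero_le _) hw)
      simp [h]
    · exact Nat.zero_le _
  have h2 : ∀ v w : Fin n, (∑ ω : Selection n q,
      if v ≠ w ∧ v ∈ selVars ω ∧ w ∈ selVars ω then k else 0) * q ^ 2 ≤
        k * Fintype.card (Selection n q) := by
    intro v w
    by_cases hvw : v = w
    · simp [hvw]
    · have := card_selVars_pair_mul_le (q := q) v w hvw
      rw [← Finset.sum_filter, Finset.sum_const, smul_eq_mul]
      simp only [ne_eq, hvw, not_false_eq_true, true_and]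
      nlinarith
  calc (∑ ω : Selection n q, (spoiledVars F ω).card) * q ^ 2
      ≤ (∑ ω : Selection n q, ∑ i, ∑ v ∈ (F i).vars, ∑ w ∈ (F i).vars,
        if v ≠ w ∧ v ∈ selVars ω ∧ w ∈ selVars ω then k else 0) * q ^ 2 := by
        gcongr with ω
        exact h1 ω
    _ = ∑ i, ∑ v ∈ (F i).vars, ∑ w ∈ (F i).vars, (∑ ω : Selection n q,
        if v ≠ w ∧ v ∈ selVars ω ∧ w ∈ selVars ω then k else 0) * q ^ 2 := by
        rw [Finset.sum_comm, Finset.sum_mul]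
        refine Finset.sum_congr rfl fun i _ => ?_
        rw [Finset.sum_comm, Finset.sum_mul]
        refine Finset.sum_congr rfl fun v _ => ?_
        rw [Finset.sum_comm, Finset.sum_mul]
    _ ≤ ∑ i : Fin m, ∑ v ∈ (F i).vars, ∑ w ∈ (F i).vars, k * Fintype.card (Selection n q) :=
        Finset.sum_le_sum fun i _ => Finset.sum_le_sum fun v _ => Finset.sum_le_sum fun w _ =>
          h2 v w
    _ ≤ ∑ i : Fin m, k * (k * (k * Fintype.card (Selection n q))) := by
        refine Finset.sum_le_sum fun i _ => ?_
        rw [Finset.sum_const, Finset.sum_const, smul_eq_mul, smul_eq_mul]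
        have := hF i
        gcongr
    _ = m * k ^ 3 * Fintype.card (Selection n q) := by
        rw [Finset.sum_const, Finset.card_univ, Fintype.card_fin, smul_eq_mul]
        ring

/-- At least half of the selections spoil at most `τ` variables, by Markov's inequality. -/
lemma card_selection_le_two_mul_card (F : CNF n m) {k τ : ℕ} (hq : 0 < q)
    (hF : ∀ i, (F i).vars.card ≤ k) (hτ : 2 * m * k ^ 3 ≤ τ * q ^ 2) :
    Fintype.card (Selection n q) ≤
      2 * (Finset.card {ω : Selection n q | (spoiledVars F ω).card ≤ τ}) := by
  classical
  have h1 := sum_card_spoiledVars_mul_le (q := q) F hF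
  have h2 : (Finset.card {ω : Selection n q | ¬ (spoiledVars F ω).card ≤ τ}) * (τ + 1) ≤
      ∑ ω : Selection n q, (spoiledVars F ω).card := by
    rw [← smul_eq_mul]
    refine (Finset.card_nsmul_le_sum _ _ _ fun ω hω => ?_).trans
      (Finset.sum_le_univ_sum_of_nonneg fun _ => Nat.zero_le _)
    rw [Finset.mem_filter] at hω
    omega
  have h3 := Finset.card_filter_add_card_filter_not (s := (Finset.univ : Finset (Selection n q)))
    (fun ω => (spoiledVars F ω).card ≤ τ)
  rw [Finset.card_univ] at h3
  generalize Fintype.card (Selection n q) = T at *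
  generalize (Finset.card {ω : Selection n q | ¬ (spoiledVars F ω).card ≤ τ}) = b at *
  generalize (Finset.card {ω : Selection n q | (spoiledVars F ω).card ≤ τ}) = g at *
  suffices 2 * b ≤ T by omega
  have h4 : (2 * b) * ((τ + 1) * q ^ 2) ≤ T * ((τ + 1) * q ^ 2) := by
    calc (2 * b) * ((τ + 1) * q ^ 2) = 2 * ((b * (τ + 1)) * q ^ 2) := by ring
      _ ≤ 2 * (m * k ^ 3 * T) := by
          refine Nat.mul_le_mul_left _ (le_trans (Nat.mul_le_mul_right _ h2) h1)
      _ = (2 * m * k ^ 3) * T := by ring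
      _ ≤ (τ * q ^ 2) * T := by gcongr
      _ ≤ ((τ + 1) * q ^ 2) * T := by gcongr; omega
      _ = T * ((τ + 1) * q ^ 2) := by ring
  exact Nat.le_of_mul_le_mul_right h4 (by positivity)

/-- Except for fewer than `q` variables, the variables of `C` can be chosen. -/
lemma card_vars_le_sum (hq : 0 < q) (C : Clause n) :
    C.vars.card ≤ (∑ t : Fin (n / q), (intervalLits t C).card)
      + q := by
  classical
  have hsub : C.vars ⊆ ((Finset.univ : Finset (Fin (n / q))).biUnion fun t =>
      (intervalLits t C).image fun x => intervalVar t x.1) ∪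
      (Finset.univ.filter fun v : Fin n => n / q * q ≤ (v : ℕ)) := by
    intro v hv
    rw [Finset.mem_union]
    by_cases h : (v : ℕ) < n / q * q
    · left
      obtain ⟨t, a, rfl⟩ := exists_intervalVar_eq hq v h
      obtain ⟨b, hb⟩ := Clause.mem_vars.1 hv
      exact Finset.mem_biUnion.2 ⟨t, Finset.mem_univ _, Finset.mem_image.2
        ⟨(a, b), by simpa [intervalLits] using hb, rfl⟩⟩
    · right
      simpa using h
  refine (Finset.card_le_card hsub).trans ((Finset.card_union_le _ _).trans (add_le_add ?_ ?_))
  · exact Finset.card_biUnion_le.trans (Finset.sum_le_sum fun t _ => Finset.card_image_le)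
  · have h1 : ({v : Fin n | n / q * q ≤ (v : ℕ)} : Finset (Fin n)).card ≤
        (Finset.Ico (n / q * q) n).card := by
      refine Finset.card_le_card_of_injOn (fun v => (v : ℕ)) ?_ fun a _ b _ h => Fin.ext h
      intro v hv
      simp only [Finset.coe_filter, Finset.mem_univ, true_and, Set.mem_ofPred_eq] at hv
      simpa using hv
    rw [Nat.card_Ico] at h1
    have h2 := Nat.div_add_mod n q
    have h3 := Nat.mod_lt n hq
    rw [mul_comm] at h2
    omega

/-- A Chernoff bound: few selections contain at most `τ` literals of a wide clause. It follows by
averaging `2 ^ (-X)`, where `X` is the number of literals of `C` that are selected. -/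
lemma card_selLit_le_le (hq : 0 < q) (C : Clause n) (τ : ℕ) :
    ((Finset.card {ω : Selection n q | (hits ω C).card ≤ τ}) : ℝ) ≤
      2 ^ τ * (Fintype.card (Selection n q) *
        Real.exp (-(((C.vars.card : ℝ) - q) / (4 * q)))) := by
  classical
  have hq' : (0 : ℝ) < q := by exact_mod_cast hq
  let φ : Fin (n / q) → Fin q × Bool → ℝ := fun t x =>
    if (intervalVar t x.1, x.2) ∈ C then 1 / 2 else 1
  have hφ : ∀ ω : Selection n q, ∏ t, φ t (ω t) = (1 / 2) ^ (hits ω C).card := by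
    intro ω
    simp only [φ]
    rw [Finset.prod_ite, Finset.prod_const, Finset.prod_const_one, mul_one]
    rfl
  have h1 : ((Finset.card {ω : Selection n q | (hits ω C).card ≤ τ}) : ℝ) ≤
      ∑ ω : Selection n q, 2 ^ τ * ∏ t, φ t (ω t) := by
    rw [Finset.card_filter, Nat.cast_sum]
    refine Finset.sum_le_sum fun ω _ => ?_
    rw [hφ]
    split_ifs with h
    · have : (1 / 2 : ℝ) ^ τ ≤ (1 / 2) ^ (hits ω C).card :=
        pow_le_pow_of_le_one (by norm_num) (by norm_num) h
      calc ((1 : ℕ) : ℝ) = 2 ^ τ * (1 / 2 : ℝ) ^ τ := by rw [← mul_pow]; norm_num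
        _ ≤ _ := by gcongr
    · push_cast
      positivity
  have h2 : ∑ ω : Selection n q, ∏ t, φ t (ω t) = ∏ t, ∑ x, φ t x := by
    rw [Finset.prod_univ_sum]
    simp
  have h3 : ∀ t : Fin (n / q), ∑ x, φ t x ≤ (2 * q) *
      Real.exp (-((intervalLits t C).card / (4 * q))) := by
    intro t
    have e1 : ∑ x, φ t x =
        2 * q - (intervalLits t C).card / 2 := by
      have e2 : ∀ x, φ t x = 1 - (if (intervalVar t x.1, x.2) ∈ C then (1 : ℝ) else 0) / 2 := by
        intro x
        simp only [φ]
        split_ifs <;> norm_num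
      simp only [e2]
      rw [Finset.sum_sub_distrib, ← Finset.sum_div, Finset.sum_boole]
      simp [intervalLits, mul_comm]
    have e3 := Real.add_one_le_exp
      (-((intervalLits t C).card / (4 * q) : ℝ))
    rw [e1]
    refine le_trans (le_of_eq ?_) (mul_le_mul_of_nonneg_left e3 (by positivity))
    field_simp
    ring
  have h4 : ∏ t, ∑ x, φ t x ≤ Fintype.card (Selection n q) *
        Real.exp (-(((C.vars.card : ℝ) - q) / (4 * q))) := by
    calc ∏ t, ∑ x, φ t x ≤ ∏ t : Fin (n / q), ((2 * q) *
          Real.exp (-((intervalLits t C).card / (4 * q)))) := by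
          refine Finset.prod_le_prod (fun t _ => Finset.sum_nonneg fun x _ => ?_) fun t _ => h3 t
          simp only [φ]
          split_ifs <;> norm_num
      _ = Fintype.card (Selection n q) * Real.exp (-((∑ t : Fin (n / q),
          ((intervalLits t C).card : ℝ)) / (4 * q))) := by
          rw [Finset.prod_mul_distrib, ← Real.exp_sum, card_selection, Finset.sum_neg_distrib,
            Finset.sum_div]
          simp
      _ ≤ _ := by
          have := card_vars_le_sum hq C
          have h5 : (C.vars.card : ℝ) ≤ (∑ t : Fin (n / q),
            ((intervalLits t C).card : ℝ)) + q := by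
            exact_mod_cast this
          gcongr
          linarith
  rw [← Finset.mul_sum, h2] at h1
  exact h1.trans (by gcongr)

lemma two_mul_pow_div_le_two_pow (hq : 0 < q) : (2 * q) ^ (n / q) ≤ 2 ^ n := by
  have h1 : 2 * q ≤ 2 ^ q := by
    obtain ⟨q, rfl⟩ : ∃ q', q = q' + 1 := ⟨q - 1, by omega⟩
    have := Nat.lt_two_pow_self (n := q)
    rw [pow_succ]
    omega
  calc (2 * q) ^ (n / q) ≤ (2 ^ q) ^ (n / q) := Nat.pow_le_pow_left h1 _
    _ = 2 ^ (q * (n / q)) := by rw [pow_mul]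
    _ ≤ 2 ^ n := Nat.pow_le_pow_right (by norm_num) (Nat.mul_div_le n q)

/-- The reduction for an expanding formula. The index `y` of the pigeonhole principle runs over the
selections that spoil at most `τ` variables. -/
theorem VarExpanding.reducesToRwPHPPLS {L k s τ : ℕ} {F : CNF n m} (hk : 8 ≤ k) (hq : 0 < q)
    (hs : 1 ≤ s) (hL : 1 ≤ L) (hF : ∀ i, (F i).vars.card ≤ k) (hexp : VarExpanding F k 3 (2 * s))
    (hτ : 2 * m * k ^ 3 ≤ τ * q ^ 2)
    (h1 : 4 * (L : ℝ) * (2 ^ τ * Real.exp (-(((s : ℝ) - q) / (4 * q)))) ≤ 1)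
    (h2 : 4 * L ≤ (2 * q) ^ (n / q)) :
    ReducesToRwPHPPLS (refuter F L) 2 := by
  classical
  let G : Finset (Selection n q) := {ω | (spoiledVars F ω).card ≤ τ}
  have hG := card_selection_le_two_mul_card F hq hF hτ
  change _ ≤ 2 * G.card at hG
  rw [card_selection] at hG
  have hGle : G.card ≤ 2 ^ n := (Finset.card_le_univ G).trans
    (card_selection.le.trans (two_mul_pow_div_le_two_pow hq))
  let e := G.equivFin.symm
  have hbe : ∀ ω : Selection n q, BoundaryExpanding F (selRestriction F ω) (2 * s) := fun ω =>
    hexp.boundaryExpanding hk hF (card_selRestriction_le_one F ω)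
  have hB : 1 ≤ G.card / (2 * L) := by
    rw [Nat.one_le_div_iff (by omega)]
    omega
  have hN : 2 * (L * (G.card / (2 * L))) ≤ G.card := by
    rw [← mul_assoc]
    exact Nat.mul_div_le _ _
  refine reducesToRwPHPPLS_of_medium_count (s := s) (N := G.card) (B := G.card / (2 * L)) F
    (fun y => selRestriction F (e y).1) hL hB hN hs (fun y => (hbe _).not_implied_empty) ?_
    (bitLength_rwPHP_le_blockBits F hL (Nat.mul_pos hL hB) hN hGle)
  intro C
  by_cases hne : ∃ y, Medium F (selRestriction F (e y).1) s C
  · obtain ⟨y₀, hy₀⟩ := hne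
    have hwide := (hy₀.wide (hbe _)).1
    have hle : {y | Medium F (selRestriction F (e y).1) s C}.ncard ≤
        (Finset.card {ω : Selection n q | (hits ω C).card ≤ τ}) := by
      refine le_trans (Set.ncard_le_ncard_of_injOn (fun y => (e y).1) ?_ ?_ (Set.toFinite _))
        (Set.ncard_coe_finset _).le
      · intro y hy
        have h3 := card_selLit_le_card_spoiledVars F (e y).1 C (hy.wide (hbe _)).2
        have h4 := (Finset.mem_filter.1 (e y).2).2
        simpa using h3.trans h4
      · intro y _ y' _ h
        exact e.injective (Subtype.ext h)
    have hch := card_selLit_le_le hq C τ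
    refine hle.trans ((Nat.le_div_iff_mul_le (by omega)).2 ?_)
    generalize (Finset.card {ω : Selection n q | (hits ω C).card ≤ τ}) = b at *
    rw [card_selection] at hch
    set T : ℝ := (((2 * q) ^ (n / q) : ℕ) : ℝ) with hT
    have hmono : Real.exp (-(((C.vars.card : ℝ) - q) / (4 * q))) ≤
        Real.exp (-(((s : ℝ) - q) / (4 * q))) := by
      have : (s : ℝ) ≤ C.vars.card := by exact_mod_cast hwide.le
      gcongr
    have hGr : T ≤ 2 * (G.card : ℝ) := by
      rw [hT]
      exact_mod_cast hG
    have hfin : 2 * ((b : ℝ) * (2 * L)) ≤ T := by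
      calc 2 * ((b : ℝ) * (2 * L)) ≤ 2 * ((2 ^ τ * (T *
            Real.exp (-(((s : ℝ) - q) / (4 * q))))) * (2 * L)) := by
            gcongr
            exact hch.trans (by gcongr)
        _ = T * (4 * (L : ℝ) * (2 ^ τ * Real.exp (-(((s : ℝ) - q) / (4 * q))))) := by ring
        _ ≤ T * 1 := by gcongr
        _ = T := mul_one T
    have hres : (b : ℝ) * (2 * L) ≤ G.card := by linarith
    exact_mod_cast hres
  · push Not at hne
    simp [hne]

end Restrictions


/-! ### Counting ordinary clauses -/

section Counting

variable {n k : ℕ}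

lemma card_vars_of_mem_ordinaryClauses {C : Clause n} (hC : C ∈ ordinaryClauses k n) :
    C.vars.card = k := by
  classical
  rw [← hC.1]
  refine Finset.card_image_of_injOn ?_
  rintro ⟨v, b⟩ hb ⟨w, d⟩ hd (h : v = w)
  subst h
  have := hC.2 v
  rw [Finset.mem_coe] at hb hd
  cases b <;> cases d <;> simp_all

/-- An ordinary clause is determined by its variables and the set of those that occur
positively. -/
lemma ncard_ordinaryClauses_vars_subset (T : Finset (Fin n)) :
    {C | C ∈ ordinaryClauses k n ∧ C.vars ⊆ T}.ncard = T.card.choose k * 2 ^ k := by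
  classical
  have hcard : ((T.powersetCard k).sigma fun S => S.powerset).card = T.card.choose k * 2 ^ k := by
    rw [Finset.card_sigma, Finset.sum_congr rfl (g := fun _ => 2 ^ k), Finset.sum_const,
      Finset.card_powersetCard, smul_eq_mul]
    intro S hS
    rw [Finset.card_powerset, (Finset.mem_powersetCard.1 hS).2]
  have hset : {C | C ∈ ordinaryClauses k n ∧ C.vars ⊆ T} =
      ((Finset.univ.filter fun C : Clause n => C ∈ ordinaryClauses k n ∧ C.vars ⊆ T :
        Finset (Clause n)) : Set (Clause n)) := by
    ext C; simp
  rw [hset, Set.ncard_coe_finset, ← hcard]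
  symm
  refine Finset.card_nbij' (fun x => x.1.image fun v => (v, decide (v ∈ x.2)))
    (fun C => ⟨C.vars, {v ∈ C.vars | (v, true) ∈ C}⟩) ?_ ?_ ?_ ?_
  · rintro ⟨S, P⟩ hx
    simp only [Finset.coe_sigma, Set.mem_sigma_iff, Finset.mem_coe, Finset.mem_powersetCard,
      Finset.mem_powerset] at hx
    simp only [Finset.coe_filter, Finset.mem_univ, true_and, Set.mem_ofPred_eq]
    refine ⟨⟨?_, ?_⟩, ?_⟩
    · rw [Finset.card_image_of_injective _ fun a b h => (Prod.ext_iff.1 h).1, hx.1.2]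
    · intro v
      simp only [Finset.mem_image, Prod.mk.injEq]
      rintro ⟨⟨a, -, rfl, ha⟩, ⟨b, -, rfl, hb⟩⟩
      rw [ha] at hb
      cases hb
    · intro v hv
      obtain ⟨b, hb⟩ := Clause.mem_vars.1 hv
      obtain ⟨w, hw, hwv⟩ := Finset.mem_image.1 hb
      obtain rfl : w = v := (Prod.ext_iff.1 hwv).1
      exact hx.1.1 hw
  · intro C hC
    simp only [Finset.coe_filter, Finset.mem_univ, true_and, Set.mem_ofPred_eq] at hC
    simp only [Finset.coe_sigma, Set.mem_sigma_iff, Finset.mem_coe, Finset.mem_powersetCard,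
      Finset.mem_powerset]
    exact ⟨⟨hC.2, card_vars_of_mem_ordinaryClauses hC.1⟩, Finset.filter_subset _ _⟩
  · rintro ⟨S, P⟩ hx
    simp only [Finset.coe_sigma, Set.mem_sigma_iff, Finset.mem_coe, Finset.mem_powersetCard,
      Finset.mem_powerset] at hx
    have h1 : Clause.vars (S.image fun v => (v, decide (v ∈ P))) = S := by
      ext v
      simp [Clause.mem_vars]
    simp only
    rw [h1]
    congr 1
    ext v
    simp only [Finset.mem_filter, Finset.mem_image, Prod.mk.injEq, decide_eq_true_eq]
    constructor
    · rintro ⟨-, w, -, rfl, h⟩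
      exact h
    · exact fun h => ⟨hx.2 h, v, hx.2 h, rfl, h⟩
  · intro C hC
    simp only [Finset.coe_filter, Finset.mem_univ, true_and, Set.mem_ofPred_eq] at hC
    ext ⟨v, b⟩
    simp only [Finset.mem_image, Finset.mem_filter, Prod.mk.injEq]
    have hv := hC.1.2 v
    constructor
    · rintro ⟨w, hw, rfl, rfl⟩
      obtain ⟨d, hd⟩ := Clause.mem_vars.1 hw
      by_cases ht : (w, true) ∈ C
      · simp [hw, ht]
      · cases d
        · simpa [hw, ht] using hd
        · exact absurd hd ht
    · intro h
      have hw : v ∈ C.vars := Clause.mem_vars.2 ⟨b, h⟩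
      refine ⟨v, hw, rfl, ?_⟩
      cases b
      · simp only [decide_eq_false_iff_not]
        exact fun h' => hv ⟨h'.2, h⟩
      · simpa [hw] using h

lemma ncard_ordinaryClauses : (ordinaryClauses k n).ncard = n.choose k * 2 ^ k := by
  simpa using ncard_ordinaryClauses_vars_subset (n := n) (k := k) Finset.univ

/-- Among the ordinary clauses over any `k` variables, one is falsified by `α`. -/
lemma choose_le_ncard_not_sat (α : Fin n → Bool) :
    n.choose k ≤ {C | C ∈ ordinaryClauses k n ∧ ¬ C.Sat α}.ncard := by
  classical
  have h : (Finset.univ.powersetCard k : Finset (Finset (Fin n))).card = n.choose k := by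
    simp
  rw [← h, ← Set.ncard_coe_finset]
  refine Set.ncard_le_ncard_of_injOn (fun S => S.image fun v => (v, !α v)) ?_ ?_ (Set.toFinite _)
  · intro S hS
    rw [Finset.mem_coe, Finset.mem_powersetCard] at hS
    refine ⟨⟨?_, ?_⟩, ?_⟩
    · rw [Finset.card_image_of_injective _ fun a b h => (Prod.ext_iff.1 h).1, hS.2]
    · intro v
      simp only [Finset.mem_image, Prod.mk.injEq]
      rintro ⟨⟨a, -, rfl, ha⟩, ⟨b, -, rfl, hb⟩⟩
      rw [ha] at hb
      cases hb
    · rintro ⟨l, hl, hl'⟩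
      obtain ⟨v, -, rfl⟩ := Finset.mem_image.1 hl
      simp at hl'
  · intro S _ S' _ h
    have := congrArg Clause.vars h
    simpa [Clause.vars, Finset.image_image, Function.comp_def] using this

lemma choose_mul_pow_le {t n : ℕ} (h : t ≤ n) (k : ℕ) :
    t.choose k * n ^ k ≤ n.choose k * t ^ k := by
  have hd : ∀ k, t.descFactorial k * n ^ k ≤ n.descFactorial k * t ^ k := by
    intro k
    induction k with
    | zero => simp
    | succ k ih =>
      rw [Nat.descFactorial_succ, Nat.descFactorial_succ, pow_succ, pow_succ]
      have h1 : (t - k) * n ≤ (n - k) * t := by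
        rw [Nat.sub_mul, Nat.sub_mul, mul_comm n t]
        have : k * t ≤ k * n := Nat.mul_le_mul_left _ h
        omega
      calc (t - k) * t.descFactorial k * (n ^ k * n)
          = ((t - k) * n) * (t.descFactorial k * n ^ k) := by ring
        _ ≤ ((n - k) * t) * (n.descFactorial k * t ^ k) := Nat.mul_le_mul h1 ih
        _ = _ := by ring
  have := hd k
  rw [Nat.descFactorial_eq_factorial_mul_choose, Nat.descFactorial_eq_factorial_mul_choose,
    mul_assoc, mul_assoc] at this
  exact Nat.le_of_mul_le_mul_left this (Nat.factorial_pos k)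

end Counting

/-! ### Random CNFs -/

section Random

variable {n k m : ℕ}

instance instMeasurableSingletonClassClause : MeasurableSingletonClass (Clause n) :=
  ⟨fun _ => trivial⟩

lemma ordinaryClauses_nonempty (hkn : k ≤ n) : (ordinaryClauses k n).Nonempty := by
  rw [← Set.ncard_pos (Set.toFinite _), ncard_ordinaryClauses]
  have := Nat.choose_pos hkn
  positivity

lemma isProbabilityMeasure_uniformOn_ordinaryClauses (hkn : k ≤ n) :
    IsProbabilityMeasure (uniformOn (ordinaryClauses k n)) :=
  isProbabilityMeasure_uniformOn (Set.toFinite _) (ordinaryClauses_nonempty hkn)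

lemma real_uniformOn_ordinaryClauses (A : Set (Clause n)) :
    (uniformOn (ordinaryClauses k n)).real A =
      {C | C ∈ ordinaryClauses k n ∧ C ∈ A}.ncard / ((n.choose k : ℝ) * 2 ^ k) := by
  have hc : ∀ S : Set (Clause n), (Measure.count S).toReal = S.ncard := by
    intro S
    rw [Measure.count_apply_finite S (Set.toFinite S), Set.ncard_eq_toFinset_card S]
    simp
  rw [measureReal_def, uniformOn, cond_apply (Set.toFinite _).measurableSet, ENNReal.toReal_mul,
    ENNReal.toReal_inv, hc, hc, ncard_ordinaryClauses]
  push_cast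
  rw [div_eq_inv_mul]
  rfl

lemma real_uniformOn_vars_subset_le (hkn : k ≤ n) (T : Finset (Fin n)) :
    (uniformOn (ordinaryClauses k n)).real {C | C.vars ⊆ T} ≤ ((T.card : ℝ) / n) ^ k := by
  rw [real_uniformOn_ordinaryClauses]
  have h := ncard_ordinaryClauses_vars_subset (k := k) T
  simp only [Set.mem_ofPred_eq] at h ⊢
  rw [h]
  have h1 : 0 < (n.choose k : ℝ) := by exact_mod_cast Nat.choose_pos hkn
  have h2 := choose_mul_pow_le (by simpa using Finset.card_le_univ T) k (t := T.card) (n := n)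
  have h2' : (T.card.choose k : ℝ) * n ^ k ≤ n.choose k * T.card ^ k := by exact_mod_cast h2
  rcases Nat.eq_zero_or_pos n with rfl | hn
  · have hk : k = 0 := by omega
    subst hk
    simp
  · have hn' : (0 : ℝ) < n := by exact_mod_cast hn
    push_cast
    rw [div_pow, div_le_div_iff₀ (by positivity) (by positivity)]
    have : (0 : ℝ) < 2 ^ k := by positivity
    nlinarith

lemma real_uniformOn_sat_le (hkn : k ≤ n) (α : Fin n → Bool) :
    (uniformOn (ordinaryClauses k n)).real {C | C.Sat α} ≤ 1 - 1 / 2 ^ k := by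
  have := isProbabilityMeasure_uniformOn_ordinaryClauses hkn
  have h1 : 0 < (n.choose k : ℝ) := by exact_mod_cast Nat.choose_pos hkn
  have h2 : 1 / 2 ^ k ≤ (uniformOn (ordinaryClauses k n)).real {C | C.Sat α}ᶜ := by
    rw [real_uniformOn_ordinaryClauses]
    have h := choose_le_ncard_not_sat (k := k) α
    have h' : (n.choose k : ℝ) ≤ {C | C ∈ ordinaryClauses k n ∧ ¬ C.Sat α}.ncard := by
      exact_mod_cast h
    simp only [Set.mem_compl_iff, Set.mem_ofPred_eq]
    rw [div_le_div_iff₀ (by positivity) (by positivity)]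
    have : (0 : ℝ) < 2 ^ k := by positivity
    nlinarith
  rw [probReal_compl_eq_one_sub (Set.toFinite _).measurableSet] at h2
  linarith

lemma isProbabilityMeasure_randomKCNF (hkn : k ≤ n) :
    IsProbabilityMeasure (randomKCNF k n m) := by
  have := isProbabilityMeasure_uniformOn_ordinaryClauses hkn
  unfold randomKCNF
  infer_instance

/-- The clauses with index in `J` all belong to `A` with probability the power of that of `A`. -/
lemma real_randomKCNF_forall_mem (hkn : k ≤ n) (J : Finset (Fin m)) (A : Set (Clause n)) :
    (randomKCNF k n m).real {F | ∀ i ∈ J, F i ∈ A} =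
      (uniformOn (ordinaryClauses k n)).real A ^ J.card := by
  classical
  have := isProbabilityMeasure_uniformOn_ordinaryClauses hkn
  have hset : {F : CNF n m | ∀ i ∈ J, F i ∈ A} =
      Set.pi Set.univ fun i => if i ∈ J then A else Set.univ := by
    ext F
    simp only [Set.mem_ofPred_eq, Set.mem_pi, Set.mem_univ, true_implies]
    refine forall_congr' fun i => ?_
    split_ifs with h <;> simp [h]
  rw [hset, measureReal_def, randomKCNF, Measure.pi_pi, ENNReal.toReal_prod]
  have : ∀ i, (uniformOn (ordinaryClauses k n) (if i ∈ J then A else Set.univ)).toReal =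
      if i ∈ J then (uniformOn (ordinaryClauses k n)).real A else 1 := by
    intro i
    split_ifs
    · rfl
    · simp
  simp only [this]
  rw [Finset.prod_ite, Finset.prod_const, Finset.prod_const_one, mul_one]
  simp

lemma real_randomKCNF_not_unsat_le (hkn : k ≤ n) :
    (randomKCNF k n m).real {F | ¬ F.Unsat} ≤ 2 ^ n * (1 - 1 / 2 ^ k) ^ m := by
  have := isProbabilityMeasure_randomKCNF (m := m) hkn
  have hset : {F : CNF n m | ¬ F.Unsat} ⊆
      ⋃ α ∈ (Finset.univ : Finset (Fin n → Bool)),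
        {F : CNF n m | ∀ i ∈ Finset.univ, F i ∈ {C : Clause n | C.Sat α}} := by
    intro F hF
    simp only [CNF.Unsat, not_not, Set.mem_ofPred_eq] at hF
    obtain ⟨α, hα⟩ := hF
    simp only [Set.mem_iUnion]
    exact ⟨α, Finset.mem_univ _, fun i _ => hα i⟩
  calc _ ≤ (randomKCNF k n m).real _ := measureReal_mono hset (measure_ne_top _ _)
    _ ≤ ∑ α : Fin n → Bool, (randomKCNF k n m).real
        {F : CNF n m | ∀ i ∈ Finset.univ, F i ∈ {C : Clause n | C.Sat α}} :=
        measureReal_biUnion_finset_le _ _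
    _ ≤ ∑ α : Fin n → Bool, (1 - 1 / 2 ^ k : ℝ) ^ m := by
        refine Finset.sum_le_sum fun α _ => ?_
        rw [real_randomKCNF_forall_mem hkn, Finset.card_univ, Fintype.card_fin]
        exact pow_le_pow_left₀ measureReal_nonneg (real_uniformOn_sat_le hkn α) m
    _ = 2 ^ n * (1 - 1 / 2 ^ k) ^ m := by simp

lemma real_randomKCNF_not_ordinary (hkn : k ≤ n) :
    (randomKCNF k n m).real {F | ¬ ∀ i, F i ∈ ordinaryClauses k n} = 0 := by
  have h1 := isProbabilityMeasure_randomKCNF (m := m) hkn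
  have h2 := real_randomKCNF_forall_mem (m := m) hkn Finset.univ (ordinaryClauses k n)
  have h3 : (uniformOn (ordinaryClauses k n)).real (ordinaryClauses k n) = 1 := by
    rw [measureReal_def, uniformOn_self (Set.toFinite _) (ordinaryClauses_nonempty hkn)]
    simp
  rw [h3, one_pow] at h2
  have h4 : {F : CNF n m | ¬ ∀ i, F i ∈ ordinaryClauses k n} =
      {F : CNF n m | ∀ i ∈ Finset.univ, F i ∈ ordinaryClauses k n}ᶜ := by
    ext F; simp
  rw [h4, probReal_compl_eq_one_sub (Set.toFinite _).measurableSet, h2, sub_self]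

/-- The union bound over sets of `j` clauses and of `(k - 3) * j` variables containing them. -/
lemma real_randomKCNF_not_varExpanding_le_sum {r : ℕ} (hkn : k ≤ n) (hr : (k - 3) * r ≤ n) :
    (randomKCNF k n m).real {F | ¬ VarExpanding F k 3 r} ≤
      ∑ j ∈ Finset.Icc 1 r, (m.choose j : ℝ) * (n.choose ((k - 3) * j) *
        ((((k - 3) * j : ℕ) : ℝ) / n) ^ (k * j)) := by
  classical
  have := isProbabilityMeasure_randomKCNF (m := m) hkn
  have hset : {F : CNF n m | ¬ VarExpanding F k 3 r} ⊆
      ⋃ j ∈ Finset.Icc 1 r, ⋃ J ∈ (Finset.univ : Finset (Fin m)).powersetCard j,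
        ⋃ T ∈ (Finset.univ : Finset (Fin n)).powersetCard ((k - 3) * j),
          {F : CNF n m | ∀ i ∈ J, F i ∈ {C : Clause n | C.vars ⊆ T}} := by
    intro F hF
    simp only [VarExpanding, Set.mem_ofPred_eq] at hF
    push Not at hF
    obtain ⟨J, hJ, hv⟩ := hF
    have hJ1 : 1 ≤ J.card := by
      by_contra hcon
      have : J.card = 0 := by omega
      rw [this] at hv
      omega
    obtain ⟨T, hT1, hT2⟩ := Finset.exists_superset_card_eq hv.le
      (by simpa using (Nat.mul_le_mul_left (k - 3) hJ).trans hr)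
    simp only [Set.mem_iUnion]
    exact ⟨J.card, Finset.mem_Icc.2 ⟨hJ1, hJ⟩, J, by simp, T, by simp [hT2], fun i hi =>
      (Finset.subset_biUnion_of_mem (fun i => (F i).vars) hi).trans hT1⟩
  refine (measureReal_mono hset (measure_ne_top _ _)).trans ((measureReal_biUnion_finset_le _ _).trans
    (Finset.sum_le_sum fun j _ => ?_))
  have hJ : ∀ J ∈ (Finset.univ : Finset (Fin m)).powersetCard j,
      (randomKCNF k n m).real (⋃ T ∈ (Finset.univ : Finset (Fin n)).powersetCard ((k - 3) * j),
          {F : CNF n m | ∀ i ∈ J, F i ∈ {C : Clause n | C.vars ⊆ T}}) ≤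
        n.choose ((k - 3) * j) * ((((k - 3) * j : ℕ) : ℝ) / n) ^ (k * j) := by
    intro J hJ
    refine (measureReal_biUnion_finset_le _ _).trans
      ((Finset.sum_le_card_nsmul _ _ (((((k - 3) * j : ℕ) : ℝ) / n) ^ (k * j))
        fun T hT => ?_).trans_eq ?_)
    · rw [real_randomKCNF_forall_mem hkn, (Finset.mem_powersetCard.1 hJ).2, pow_mul]
      refine pow_le_pow_left₀ measureReal_nonneg ?_ j
      rw [← (Finset.mem_powersetCard.1 hT).2]
      exact real_uniformOn_vars_subset_le hkn T
    · simp
  refine (measureReal_biUnion_finset_le _ _).trans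
    ((Finset.sum_le_card_nsmul _ _ _ hJ).trans_eq ?_)
  simp

lemma choose_le_exp_mul_div_pow (a b : ℕ) :
    (a.choose b : ℝ) ≤ (Real.exp 1 * (a / b)) ^ b := by
  rcases Nat.eq_zero_or_pos b with rfl | hb
  · simp
  have hb' : (0 : ℝ) < b := by exact_mod_cast hb
  have h1 : (a.choose b : ℝ) ≤ a ^ b / b.factorial := Nat.choose_le_pow_div b a
  have h2 : (b : ℝ) ^ b / b.factorial ≤ Real.exp b := Real.pow_div_factorial_le_exp _ hb'.le b
  have hf : (0 : ℝ) < b.factorial := by exact_mod_cast b.factorial_pos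
  calc (a.choose b : ℝ) ≤ a ^ b / b.factorial := h1
    _ = (b ^ b / b.factorial) * (a / b) ^ b := by
        rw [div_pow]
        field_simp
    _ ≤ Real.exp b * (a / b) ^ b := by gcongr
    _ = _ := by rw [mul_pow, ← Real.exp_nat_mul, mul_one]

/-- With `A = exp k * c * k ^ 3`, the term for `j` of the union bound is at most
`(A * (j / n) ^ 2) ^ j`. -/
lemma union_bound_term_le {c : ℝ} (hc : 0 ≤ c) (hk : 3 ≤ k) {j : ℕ} (hj : 1 ≤ j) (hn : 0 < n)
    (hm : (m : ℝ) ≤ c * n) :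
    (m.choose j : ℝ) * (n.choose ((k - 3) * j) * ((((k - 3) * j : ℕ) : ℝ) / n) ^ (k * j)) ≤
      ((Real.exp k * c * k ^ 3) * ((j : ℝ) / n) ^ 2) ^ j := by
  obtain ⟨k, rfl⟩ : ∃ k', k = k' + 3 := ⟨k - 3, by omega⟩
  simp only [Nat.add_sub_cancel]
  have hn' : (0 : ℝ) < n := by exact_mod_cast hn
  have hj' : (0 : ℝ) < j := by exact_mod_cast hj
  have h1 : (m.choose j : ℝ) ≤ (Real.exp 1 * (c * n / j)) ^ j := by
    refine (choose_le_exp_mul_div_pow m j).trans ?_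
    gcongr
  have h2 : (n.choose (k * j) : ℝ) * (((k * j : ℕ) : ℝ) / n) ^ ((k + 3) * j) ≤
      (Real.exp k * ((k + 3 : ℕ) * j / n) ^ 3) ^ j := by
    rcases Nat.eq_zero_or_pos k with rfl | hk
    · have : (3 * j) ≠ 0 := by omega
      simp only [zero_mul, Nat.choose_zero_right, Nat.cast_one, CharP.cast_eq_zero, zero_div,
        zero_add, one_mul]
      rw [zero_pow this]
      positivity
    have hk' : (0 : ℝ) < k := by exact_mod_cast hk
    calc (n.choose (k * j) : ℝ) * (((k * j : ℕ) : ℝ) / n) ^ ((k + 3) * j)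
        ≤ (Real.exp 1 * (n / ((k * j : ℕ) : ℝ))) ^ (k * j) *
          (((k * j : ℕ) : ℝ) / n) ^ ((k + 3) * j) := by
          gcongr
          exact choose_le_exp_mul_div_pow _ _
      _ = (Real.exp 1 ^ k) ^ j * ((n / ((k * j : ℕ) : ℝ)) ^ (k * j) *
          (((k * j : ℕ) : ℝ) / n) ^ (k * j)) * ((((k * j : ℕ) : ℝ) / n) ^ 3) ^ j := by
          rw [mul_pow, add_mul, pow_add, ← pow_mul, ← pow_mul]
          ring
      _ = (Real.exp k * ((k : ℝ) * j / n) ^ 3) ^ j := by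
          rw [← mul_pow, mul_pow (Real.exp k), ← Real.exp_nat_mul, mul_one]
          push_cast
          rw [div_mul_div_cancel₀ (by positivity), div_self (by positivity), one_pow, mul_one]
      _ ≤ _ := by
          gcongr
          simp
  calc _ ≤ (Real.exp 1 * (c * n / j)) ^ j * (Real.exp k * ((k + 3 : ℕ) * j / n) ^ 3) ^ j := by
        gcongr
    _ = ((Real.exp (k + 1) * c * (k + 3 : ℕ) ^ 3) * ((j : ℝ) / n) ^ 2) ^ j := by
        rw [← mul_pow, Real.exp_add]
        congr 1
        field_simp
    _ ≤ _ := by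
        gcongr
        push_cast
        linarith

/-- The union bound is dominated by its first terms as long as `A * (j / n) ^ 2 ≤ 1 / 4`. -/
lemma real_randomKCNF_not_varExpanding_le {c : ℝ} (hc : 0 ≤ c) (hk : 3 ≤ k) (hkn : k ≤ n)
    (hm : (m : ℝ) ≤ c * n) {r : ℕ} (hr : (k - 3) * r ≤ n)
    (hrA : (Real.exp k * c * k ^ 3) * ((r : ℝ) / n) ^ 2 ≤ 1 / 4) :
    (randomKCNF k n m).real {F | ¬ VarExpanding F k 3 r} ≤
      8 * (Real.exp k * c * k ^ 3) / (n : ℝ) ^ 2 := by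
  have hn : 0 < n := by omega
  have hn' : (0 : ℝ) < n := by exact_mod_cast hn
  set A := Real.exp k * c * k ^ 3 with hA
  have hA0 : 0 ≤ A := by positivity
  have hterm : ∀ j ∈ Finset.Icc 1 r, (m.choose j : ℝ) * (n.choose ((k - 3) * j) *
      ((((k - 3) * j : ℕ) : ℝ) / n) ^ (k * j)) ≤ 8 * A / (n : ℝ) ^ 2 * (1 / 2) ^ j := by
    intro j hj
    rw [Finset.mem_Icc] at hj
    refine (union_bound_term_le hc hk hj.1 hn hm).trans ?_
    rw [← hA]
    have h1 : A * ((j : ℝ) / n) ^ 2 ≤ 1 / 4 := by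
      refine le_trans ?_ hrA
      have : (j : ℝ) ≤ r := by exact_mod_cast hj.2
      gcongr
    obtain ⟨i, rfl⟩ : ∃ i, j = i + 1 := ⟨j - 1, by omega⟩
    have hsq : ∀ i : ℕ, ((i : ℝ) + 1) ^ 2 ≤ 4 * 2 ^ i := by
      intro i
      induction i with
      | zero => norm_num
      | succ i ih =>
        rcases Nat.lt_or_ge i 2 with hi | hi
        · interval_cases i <;> norm_num
        · have : (2 : ℝ) ≤ i := by exact_mod_cast hi
          push_cast
          rw [pow_succ (2 : ℝ) i]
          nlinarith
    calc (A * (((i + 1 : ℕ) : ℝ) / n) ^ 2) ^ (i + 1)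
        = (A * (((i + 1 : ℕ) : ℝ) / n) ^ 2) ^ i * (A * (((i + 1 : ℕ) : ℝ) / n) ^ 2) := pow_succ _ _
      _ ≤ (1 / 4) ^ i * (A * (((i + 1 : ℕ) : ℝ) / n) ^ 2) := by gcongr
      _ = A / (n : ℝ) ^ 2 * ((1 / 4) ^ i * ((i : ℝ) + 1) ^ 2) := by
          push_cast
          field_simp
      _ ≤ A / (n : ℝ) ^ 2 * ((1 / 4) ^ i * (4 * 2 ^ i)) := by
          gcongr
          exact hsq i
      _ = 8 * A / (n : ℝ) ^ 2 * (1 / 2) ^ (i + 1) := by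
          have : (1 / 4 : ℝ) ^ i * (4 * 2 ^ i) = 8 * (1 / 2) ^ (i + 1) := by
            have h3 : (1 / 4 : ℝ) ^ i * 2 ^ i = (1 / 2) ^ i := by rw [← mul_pow]; norm_num
            rw [pow_succ]
            linarith
          rw [this]
          ring
  refine (real_randomKCNF_not_varExpanding_le_sum hkn hr).trans
    ((Finset.sum_le_sum hterm).trans ?_)
  rw [← Finset.mul_sum]
  have hgeo : ∑ j ∈ Finset.Icc 1 r, (1 / 2 : ℝ) ^ j ≤ 1 := by
    have : ∀ r : ℕ, ∑ j ∈ Finset.Icc 1 r, (1 / 2 : ℝ) ^ j = 1 - (1 / 2) ^ r := by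
      intro r
      induction r with
      | zero => simp
      | succ r ih =>
        rw [Finset.sum_Icc_succ_top (by omega), ih, pow_succ]
        ring
    rw [this]
    have : (0 : ℝ) ≤ (1 / 2) ^ r := by positivity
    linarith
  have : 0 ≤ 8 * A / (n : ℝ) ^ 2 := by positivity
  nlinarith

end Random


/-! ### Almost sure properties of random CNFs -/

section AlmostSure

/-- The constant which controls the probability of non-expansion. -/
def expansionConst (k : ℕ) (c : ℝ) : ℝ := Real.exp k * c * k ^ 3

/-- The random CNF with `⌊c * n⌋` clauses expands up to sets of `δ * n` clauses, where `δ` is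
this number. -/
def expansionRate (k : ℕ) (c : ℝ) : ℝ := 1 / (2 * expansionConst k c)

lemma le_expansionConst {k : ℕ} {c : ℝ} (hk : 1 ≤ k) (hc : 1 ≤ c) :
    (k : ℝ) ≤ expansionConst k c := by
  have h1 : (1 : ℝ) ≤ k := by exact_mod_cast hk
  have h2 : (1 : ℝ) ≤ Real.exp k := Real.one_le_exp (by positivity)
  have h3 : (k : ℝ) ≤ (k : ℝ) ^ 3 := le_self_pow₀ h1 (by norm_num)
  unfold expansionConst
  calc (k : ℝ) = 1 * 1 * k := by ring
    _ ≤ _ := by gcongr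

lemma one_le_of_density {k : ℕ} {c : ℝ} (hk : 8 ≤ k) (hc : (0.7 : ℝ) * 2 ^ k ≤ c) : 1 ≤ c := by
  have : (2 : ℝ) ^ 8 ≤ 2 ^ k := pow_le_pow_right₀ (by norm_num) hk
  norm_num at this hc
  linarith

/-- This is where the density `0.7 * 2 ^ k` is used: `0.7` exceeds `log 2`. -/
lemma two_pow_mul_le_geometric {k n : ℕ} {c : ℝ} (hc : (0.7 : ℝ) * 2 ^ k ≤ c) :
    (2 : ℝ) ^ n * (1 - 1 / 2 ^ k) ^ ⌊c * n⌋₊ ≤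
      Real.exp 1 * Real.exp (Real.log 2 - 0.7) ^ n := by
  have hk0 : (0 : ℝ) < 2 ^ k := by positivity
  have hk1 : (1 : ℝ) ≤ 2 ^ k := one_le_pow₀ (by norm_num)
  have h1 : (1 - 1 / 2 ^ k : ℝ) ≤ Real.exp (-(1 / 2 ^ k)) := by
    have := Real.add_one_le_exp (-(1 / 2 ^ k) : ℝ)
    linarith
  have h0 : (0 : ℝ) ≤ 1 - 1 / 2 ^ k := by
    rw [sub_nonneg, div_le_one hk0]
    exact hk1
  have hfl : c * n - 1 ≤ (⌊c * n⌋₊ : ℝ) := (Nat.sub_one_lt_floor _).le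
  have hcn : (0.7 : ℝ) * 2 ^ k * n ≤ c * n := by gcongr
  have h2 : (2 : ℝ) ^ n = Real.exp (n * Real.log 2) := by
    rw [Real.exp_nat_mul, Real.exp_log (by norm_num)]
  calc (2 : ℝ) ^ n * (1 - 1 / 2 ^ k) ^ ⌊c * n⌋₊
      ≤ Real.exp (n * Real.log 2) * Real.exp (-(1 / 2 ^ k)) ^ ⌊c * n⌋₊ := by
        rw [h2]
        gcongr
    _ = Real.exp (n * Real.log 2 - ⌊c * n⌋₊ / 2 ^ k) := by
        rw [← Real.exp_nat_mul, ← Real.exp_add]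
        congr 1
        ring
    _ ≤ Real.exp (1 + n * (Real.log 2 - 0.7)) := by
        have h3 : (0.7 * n - 1 : ℝ) ≤ ⌊c * n⌋₊ / 2 ^ k := by
          rw [le_div_iff₀ hk0]
          nlinarith
        gcongr
        linarith
    _ = _ := by rw [Real.exp_add, Real.exp_nat_mul]

lemma summable_failure_bound (A : ℝ) :
    Summable fun n : ℕ => 8 * A / (n : ℝ) ^ 2 +
      Real.exp 1 * Real.exp (Real.log 2 - 0.7) ^ n := by
  refine Summable.add ?_ ?_
  · have := (Real.summable_one_div_nat_pow (p := 2)).2 (by norm_num)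
    simpa [div_eq_mul_inv, mul_assoc] using this.mul_left (8 * A)
  · refine (summable_geometric_of_lt_one (Real.exp_pos _).le ?_).mul_left _
    rw [Real.exp_lt_one_iff]
    have := Real.log_two_lt_d9
    norm_num at this ⊢
    linarith

/-- The properties of a CNF from which the reduction is obtained, together with
unsatisfiability. -/
def Typical (k : ℕ) (c : ℝ) {n m : ℕ} (F : CNF n m) : Prop :=
  (∀ i, F i ∈ ordinaryClauses k n) ∧
    VarExpanding F k 3 (2 * ⌊expansionRate k c * n / 2⌋₊) ∧ F.Unsat

lemma real_randomKCNF_not_typical_le {k n : ℕ} {c : ℝ} (hk : 8 ≤ k)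
    (hc : (0.7 : ℝ) * 2 ^ k ≤ c) (hkn : k ≤ n) :
    (randomKCNF k n ⌊c * n⌋₊).real {F | ¬ Typical k c F} ≤
      8 * expansionConst k c / (n : ℝ) ^ 2 +
        Real.exp 1 * Real.exp (Real.log 2 - 0.7) ^ n := by
  have := isProbabilityMeasure_randomKCNF (m := ⌊c * n⌋₊) hkn
  have hc1 := one_le_of_density hk hc
  have hk' : (8 : ℝ) ≤ k := by exact_mod_cast hk
  have hn : (0 : ℝ) < n := by exact_mod_cast (show 0 < n by omega)
  have hA := le_expansionConst (show 1 ≤ k by omega) hc1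
  have hA0 : 0 < expansionConst k c := by linarith
  set s := ⌊expansionRate k c * n / 2⌋₊ with hs
  have hrate : 0 < expansionRate k c := by
    unfold expansionRate
    positivity
  have hr : ((2 * s : ℕ) : ℝ) ≤ expansionRate k c * n := by
    have : (s : ℝ) ≤ expansionRate k c * n / 2 := Nat.floor_le (by positivity)
    push_cast
    linarith
  have hrn : (k - 3) * (2 * s) ≤ n := by
    have h1 : ((k * (2 * s) : ℕ) : ℝ) ≤ n := by
      push_cast at hr ⊢
      calc (k : ℝ) * (2 * s) ≤ k * (expansionRate k c * n) := by gcongr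
        _ = (k / (2 * expansionConst k c)) * n := by
            unfold expansionRate
            ring
        _ ≤ 1 * n := by
            gcongr
            rw [div_le_one (by positivity)]
            linarith
        _ = n := one_mul _
    have h2 : k * (2 * s) ≤ n := by exact_mod_cast h1
    exact (Nat.mul_le_mul_right _ (Nat.sub_le k 3)).trans h2
  have hrA : (Real.exp k * c * k ^ 3) * (((2 * s : ℕ) : ℝ) / n) ^ 2 ≤ 1 / 4 := by
    have h1 : ((2 * s : ℕ) : ℝ) / n ≤ expansionRate k c := by
      rw [div_le_iff₀ hn]
      exact hr
    change expansionConst k c * _ ≤ _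
    calc expansionConst k c * (((2 * s : ℕ) : ℝ) / n) ^ 2
        ≤ expansionConst k c * expansionRate k c ^ 2 := by gcongr
      _ = 1 / (4 * expansionConst k c) := by
          unfold expansionRate
          field_simp
          norm_num
      _ ≤ 1 / 4 := by
          gcongr
          linarith
  have hexp := real_randomKCNF_not_varExpanding_le (by linarith) (by omega) hkn
    (Nat.floor_le (by positivity)) hrn hrA
  have hord := real_randomKCNF_not_ordinary (m := ⌊c * n⌋₊) hkn
  have huns := real_randomKCNF_not_unsat_le (m := ⌊c * n⌋₊) hkn
  have hgeo := two_pow_mul_le_geometric (n := n) hc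
  have hset : {F : CNF n ⌊c * n⌋₊ | ¬ Typical k c F} ⊆
      {F | ¬ ∀ i, F i ∈ ordinaryClauses k n} ∪
        ({F | ¬ VarExpanding F k 3 (2 * s)} ∪ {F | ¬ F.Unsat}) := by
    intro F hF
    simp only [Set.mem_union, Set.mem_ofPred_eq] at hF ⊢
    unfold Typical at hF
    tauto
  have hu1 := measureReal_mono (μ := randomKCNF k n ⌊c * n⌋₊) hset (measure_ne_top _ _)
  have hu2 := measureReal_union_le (μ := randomKCNF k n ⌊c * n⌋₊)
    {F | ¬ ∀ i, F i ∈ ordinaryClauses k n}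
    ({F | ¬ VarExpanding F k 3 (2 * s)} ∪ {F | ¬ F.Unsat})
  have hu3 := measureReal_union_le (μ := randomKCNF k n ⌊c * n⌋₊)
    {F | ¬ VarExpanding F k 3 (2 * s)} {F | ¬ F.Unsat}
  unfold expansionConst
  linarith

/-- By the Borel–Cantelli lemma, almost surely all but finitely many of the CNFs are typical. -/
lemma ae_eventually_typical {k : ℕ} {c : ℝ} (hk : 8 ≤ k) (hc : (0.7 : ℝ) * 2 ^ k ≤ c)
    {Ω : Type*} [MeasurableSpace Ω] (μ : Measure Ω) [IsProbabilityMeasure μ]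
    (F : ∀ n : ℕ, Ω → CNF n ⌊c * n⌋₊) (hF : ∀ n, Measurable (F n))
    (hlaw : ∀ n, k ≤ n → μ.map (F n) = randomKCNF k n ⌊c * n⌋₊) :
    ∀ᵐ ω ∂μ, ∀ᶠ n : ℕ in atTop, Typical k c (F n ω) := by
  let S : ℕ → Set Ω := fun n => {ω | k ≤ n ∧ ¬ Typical k c (F n ω)}
  have hA0 : 0 ≤ expansionConst k c :=
    (Nat.cast_nonneg k).trans (le_expansionConst (by omega) (one_le_of_density hk hc))
  have hS : ∀ n, μ.real (S n) ≤ 8 * expansionConst k c / (n : ℝ) ^ 2 +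
      Real.exp 1 * Real.exp (Real.log 2 - 0.7) ^ n := by
    intro n
    by_cases hkn : k ≤ n
    · have hSn : S n = F n ⁻¹' {G | ¬ Typical k c G} := by
        ext ω
        simp [S, hkn]
      rw [hSn, ← map_measureReal_apply (hF n) (Set.toFinite _).measurableSet, hlaw n hkn]
      exact real_randomKCNF_not_typical_le hk hc hkn
    · have hSn : S n = ∅ := by
        ext ω
        simp [S, hkn]
      rw [hSn, measureReal_empty]
      positivity
  have hsum : Summable fun n => μ.real (S n) :=
    Summable.of_nonneg_of_le (fun _ => measureReal_nonneg) hS (summable_failure_bound _)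
  have htop : ∑' n, μ (S n) ≠ ⊤ := by
    have := hsum.tsum_ofReal_ne_top
    have h : ∀ n, ENNReal.ofReal (μ.real (S n)) = μ (S n) := fun n => ofReal_measureReal
    simpa only [h] using this
  filter_upwards [ae_eventually_notMem htop] with ω hω
  filter_upwards [hω, eventually_ge_atTop k] with n hn hkn
  by_contra hcon
  exact hn ⟨hkn, hcon⟩

end AlmostSure

/-! ### The choice of parameters -/

/-- The interval length `q` makes the number `k ^ 3 * c * n / q ^ 2` of spoiled variables small
against the number `δ * n / q` of variables chosen in a clause of width `δ * n`. -/
lemma exists_parameters (k : ℕ) {c δ : ℝ} (hc : 0 < c) (hδ : 0 < δ) (hδ1 : δ ≤ 1) :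
    ∃ ε : ℝ, 0 < ε ∧ ∃ q : ℕ, 0 < q ∧ ∀ᶠ n : ℕ in atTop, ∃ s τ : ℕ,
      s = ⌊δ * n / 2⌋₊ ∧ 1 ≤ s ∧ 2 * ⌊c * n⌋₊ * k ^ 3 ≤ τ * q ^ 2 ∧
      ∀ L : ℕ, (L : ℝ) ≤ (1 + ε) ^ n →
        4 * (L : ℝ) * (2 ^ τ * Real.exp (-(((s : ℝ) - q) / (4 * q)))) ≤ 1 ∧
        4 * L ≤ (2 * q) ^ (n / q) := by
  set q : ℕ := ⌈256 * c * k ^ 3 / δ⌉₊ + 2 with hq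
  have hq0 : (0 : ℝ) < q := by
    rw [hq]
    positivity
  have hq2 : 2 ≤ q := by omega
  have hqc : 256 * c * k ^ 3 ≤ q * δ := by
    rw [← div_le_iff₀ hδ, hq]
    push_cast
    have := Nat.le_ceil (256 * c * k ^ 3 / δ)
    linarith
  refine ⟨δ / (64 * q), by positivity, q, by omega, ?_⟩
  have hlim : ∀ᶠ n : ℕ in atTop, 128 * q / δ ≤ (n : ℝ) :=
    tendsto_natCast_atTop_atTop.eventually_ge_atTop _
  filter_upwards [hlim] with n hn
  rw [div_le_iff₀ hδ] at hn
  have hq2' : (2 : ℝ) ≤ q := by exact_mod_cast hq2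
  have hn0 : (0 : ℝ) ≤ n := Nat.cast_nonneg n
  have hnq : 128 * (q : ℝ) ≤ n := by nlinarith
  set s := ⌊δ * n / 2⌋₊ with hs
  have hs1 : δ * n / 2 - 1 ≤ s := (Nat.sub_one_lt_floor _).le
  -- the floors cost at most a factor of two each
  have hs2 : δ * n / 4 ≤ s := by nlinarith
  set τ := ⌊(s : ℝ) / (16 * q)⌋₊ with hτ
  have hτ1 : (s : ℝ) / (16 * q) - 1 ≤ τ := (Nat.sub_one_lt_floor _).le
  have hτ2 : (τ : ℝ) ≤ s / (16 * q) := Nat.floor_le (by positivity)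
  have hτ3 : δ * n / (128 * q) ≤ τ := by
    have h1 : δ * n / (64 * q) ≤ s / (16 * q) := by
      rw [div_le_div_iff₀ (by positivity) (by positivity)]
      nlinarith
    have h2 : 1 ≤ δ * n / (128 * q) := by
      rw [one_le_div (by positivity)]
      linarith
    have h3 : δ * n / (64 * q) = 2 * (δ * n / (128 * q)) := by
      ring
    linarith
  refine ⟨s, τ, rfl, ?_, ?_, fun L hL => ?_⟩
  · have : (1 : ℝ) ≤ s := by nlinarith
    exact_mod_cast this
  · have h1 : (⌊c * n⌋₊ : ℝ) ≤ c * n := Nat.floor_le (by positivity)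
    have h2 : 2 * (⌊c * n⌋₊ : ℝ) * k ^ 3 ≤ τ * q ^ 2 := by
      calc 2 * (⌊c * n⌋₊ : ℝ) * k ^ 3 ≤ 2 * (c * n) * k ^ 3 := by gcongr
        _ = (256 * c * k ^ 3) * n / 128 := by ring
        _ ≤ (q * δ) * n / 128 := by gcongr
        _ = δ * n / (128 * q) * q ^ 2 := by field_simp
        _ ≤ τ * q ^ 2 := by gcongr
    exact_mod_cast h2
  · have hLe : (L : ℝ) ≤ Real.exp (δ * n / (64 * q)) := by
      calc (L : ℝ) ≤ (1 + δ / (64 * q)) ^ n := hL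
        _ ≤ Real.exp (δ / (64 * q)) ^ n := by
            gcongr
            rw [add_comm]
            exact Real.add_one_le_exp _
        _ = _ := by
            rw [← Real.exp_nat_mul]
            congr 1
            ring
    have h4 : (4 : ℝ) ≤ Real.exp 2 := by
      have h : (2 : ℝ) ≤ Real.exp 1 := by
        have := Real.add_one_le_exp (1 : ℝ)
        linarith
      calc (4 : ℝ) = 2 * 2 := by norm_num
        _ ≤ Real.exp 1 * Real.exp 1 := by gcongr
        _ = Real.exp 2 := by rw [← Real.exp_add]; norm_num
    have h4L : 4 * (L : ℝ) ≤ Real.exp (2 + δ * n / (64 * q)) := by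
      rw [Real.exp_add]
      gcongr
    constructor
    · have h2τ : (2 : ℝ) ^ τ ≤ Real.exp (s / (16 * q)) := by
        calc (2 : ℝ) ^ τ ≤ Real.exp 1 ^ τ := by
              gcongr
              have := Real.add_one_le_exp (1 : ℝ)
              linarith
          _ = Real.exp τ := by rw [← Real.exp_nat_mul, mul_one]
          _ ≤ _ := by gcongr
      calc 4 * (L : ℝ) * (2 ^ τ * Real.exp (-(((s : ℝ) - q) / (4 * q))))
          ≤ Real.exp (2 + δ * n / (64 * q)) *
            (Real.exp (s / (16 * q)) * Real.exp (-(((s : ℝ) - q) / (4 * q)))) := by gcongr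
        _ = Real.exp (9 / 4 + δ * n / (64 * q) - 3 * s / (16 * q)) := by
            rw [← Real.exp_add, ← Real.exp_add]
            congr 1
            field_simp
            ring
        _ ≤ Real.exp 0 := by
            gcongr
            have e1 : 3 * (δ * n / (64 * q)) ≤ 3 * s / (16 * q) := by
              rw [← mul_div_assoc, div_le_div_iff₀ (by positivity) (by positivity)]
              nlinarith
            have e2 : 2 ≤ δ * n / (64 * q) := by
              rw [le_div_iff₀ (by positivity)]
              linarith
            linarith
        _ = 1 := Real.exp_zero
    · have hdiv : (n : ℝ) / q - 1 ≤ ((n / q : ℕ) : ℝ) := by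
        have h1 : n < (n / q + 1) * q := by
          have := Nat.lt_mul_div_succ n (show 0 < q by omega)
          rw [mul_comm]
          exact this
        have h2 : (n : ℝ) < ((n / q : ℕ) + 1) * q := by exact_mod_cast h1
        have h3 : (n : ℝ) / q < ((n / q : ℕ) : ℝ) + 1 := by
          rw [div_lt_iff₀ hq0]
          exact h2
        linarith
      have h5 : 4 * (L : ℝ) ≤ (2 * q) ^ (n / q) := by
        calc 4 * (L : ℝ) ≤ Real.exp (2 + δ * n / (64 * q)) := h4L
          _ ≤ Real.exp ((n / q : ℕ) : ℝ) := by
              gcongr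
              have e1 : δ * n / (64 * q) ≤ (n : ℝ) / q / 64 := by
                rw [div_div, mul_comm (q : ℝ) 64]
                gcongr
                nlinarith
              have e2 : 128 ≤ (n : ℝ) / q := by
                rw [le_div_iff₀ hq0]
                exact hnq
              linarith
          _ = Real.exp 1 ^ (n / q) := by rw [← Real.exp_nat_mul, mul_one]
          _ ≤ (2 * q) ^ (n / q) := by
              gcongr
              have := Real.exp_one_lt_d9
              norm_num at this
              linarith
      exact_mod_cast h5

end ResRefuter

end

theorem mainTheorem11 :
    ∃ k₀ : ℕ, ∀ k : ℕ, k₀ ≤ k → ∀ c : ℝ, (0.7 : ℝ) * 2 ^ k ≤ c →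
      ∃ ε : ℝ, 0 < ε ∧
        ∀ (Ω : Type*) [MeasurableSpace Ω] (μ : Measure Ω) [IsProbabilityMeasure μ]
          (F : ∀ n : ℕ, Ω → ResRefuter.CNF n ⌊c * n⌋₊),
          (∀ n, Measurable (F n)) →
          iIndepFun F μ →
          (∀ n, k ≤ n → μ.map (F n) = ResRefuter.randomKCNF k n ⌊c * n⌋₊) →
          ∀ᵐ ω ∂μ, ∀ᶠ n : ℕ in atTop,
            ResRefuter.CNF.Unsat (F n ω) ∧
            ∀ L : ℕ, 1 ≤ L → (L : ℝ) ≤ (1 + ε) ^ n →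
              ResRefuter.ReducesToRwPHPPLS (ResRefuter.refuter (F n ω) L) 2 := by
  refine ⟨8, fun k hk c hc => ?_⟩
  have hc1 := ResRefuter.one_le_of_density hk hc
  have hA := ResRefuter.le_expansionConst (show 1 ≤ k by omega) hc1
  have hk' : (8 : ℝ) ≤ k := by exact_mod_cast hk
  have hrate : 0 < ResRefuter.expansionRate k c := by
    unfold ResRefuter.expansionRate
    have : 0 < ResRefuter.expansionConst k c := by linarith
    positivity
  have hrate1 : ResRefuter.expansionRate k c ≤ 1 := by
    unfold ResRefuter.expansionRate
    rw [div_le_one (by linarith)]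
    linarith
  obtain ⟨ε, hε, q, hq, hpar⟩ :=
    ResRefuter.exists_parameters k (show 0 < c by linarith) hrate hrate1
  refine ⟨ε, hε, fun Ω _ μ _ F hF _ hlaw => ?_⟩
  filter_upwards [ResRefuter.ae_eventually_typical hk hc μ F hF hlaw] with ω hω
  filter_upwards [hω, hpar] with n hn hparn
  obtain ⟨s, τ, rfl, hs1, hτ, hL⟩ := hparn
  refine ⟨hn.2.2, fun L hL1 hLε => ?_⟩
  obtain ⟨h1, h2⟩ := hL L hLε
  exact ResRefuter.VarExpanding.reducesToRwPHPPLS hk hq hs1 hL1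
    (fun i => (ResRefuter.card_vars_of_mem_ordinaryClauses (hn.1 i)).le) hn.2.1 hτ h1 h2
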